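/- **First-order adiabatic theorem.** Fix $N$. For every $T>0$ let $H=H_T:[0,1]\to\mathbb{C}^{N\times N}$ be a Hermitian-matrix-valued function that is differentiable three times on $[0,1]$ (one-sided at the endpoints), with bounded third derivative ($H$ may depend on $T$; all quantities below depend on $T$ through $H$). Let $U(s,0)$ be the evolution operator in dimensionless time: $\partial_s U(s,0)=-iT\,H(s)\,U(s,0)$, $U(0,0)=1$. Let $\gamma_{\min}$ be the infimum of $|a-b|$ over all $s\in[0,1]$ and all pairs of distinct eigenvalues $a\ne b$ of $H(s)$, and assume that such pairs exist and that $\gamma_{\min}>0$ for every $T$. Put $$\Delta_1=\frac1{\gamma_{\min}}\left(\frac{\|\dddot H\|}{\gamma_{\min}}+\frac{\|\ddot H\|^3}{\gamma_{\min}^3}+\frac{\|\dot H\|^6}{\gamma_{\min}^6}\right),$$ where $\|\dot H\|,\|\ddot H\|,\|\dddot H\|$ are the suprema over $s\in[0,1]$ of the operator norms of the first three derivatives of $H$. Let $|\nu(s)\rangle$, $\nu=0,\dots,N-1$, be an orthonormal basis of eigenvectors of $H(s)$ with eigenvalues $E_\nu(s)$, differentiable in $s\in[0,1]$ and chosen such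 that $\langle\dot\nu(s)|\mu(s)\rangle=0$ whenever $E_\nu(s)=E_\mu(s)$ (in particular for $\mu=\nu$). Let $G$ be an index such that $|G(s)\rangle$ is non-degenerate, i.e. $E_\nu(s)\neq E_G(s)$ for all $\nu\ne G$ and $s\in[0,1]$. Write $\gamma_{G,\nu}=E_G-E_\nu$, $\phi_\nu=T\int_0^1E_\nu(\xi)\,d\xi$ and $P_G(1)=|G(1)\rangle\langle G(1)|$. Assume that, as $T\to\infty$, $\Delta_1\in o(\gamma_{\min}T^2)$, and that there is a constant $c>0$ such that for all sufficiently large $T$ either $\Delta_1=0$ or $\gamma_{\min}\Delta_1\ge c$ (this holds automatically if $H$ does not depend on $T$). Then, as $T\to\infty$, $$(1-P_G(1))\,U(1,0)|G(0)\rangle=\left.\sum_{\nu\neq G}e^{-i\phi_\nu}|\nu(1)\rangle\,\frac{\langle\dot\nu(s_1)|G(s_1)\rangle\,e^{-iT\int_0^{s_1}\gamma_{G,\nu}(\xi)\,d\xi}}{-i\,\gamma_{G,\nu}(s_1)\,T}\right|_{s_1=0}^{1}+O\!\left(\frac{\Delta_1}{\gamma_{\min}T^2}\right).$$ -/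

import Mathlib

open Set Filter Topology Asymptotics

noncomputable section

namespace Adiabatic

/-- The state space `ℂ^N` with its Euclidean norm. -/
abbrev Ket (N : ℕ) : Type := EuclideanSpace ℂ (Fin N)

/-- Operators on `ℂ^N` (that is, `N × N` complex matrices) with the operator norm. -/
abbrev Op (N : ℕ) : Type := Ket N →L[ℂ] Ket N

/-- The interval `[0,1]` of dimensionless times. -/
abbrev unitTime : Set ℝ := Icc (0 : ℝ) 1

/-- The `k`-th derivative of `H` on `[0,1]` (one-sided at the endpoints). -/
def derivH {N : ℕ} (k : ℕ) (H : ℝ → Op N) (s : ℝ) : Op N :=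
  iteratedDerivWithin k H unitTime s

/-- A Hamiltonian on `[0,1]` that is differentiable three times. Only the values of `H` on `[0,1]`
matter. The last field says that the supremum of the norm of the third derivative is finite;
for the derivatives of lower order this is automatic. -/
structure IsHamiltonian {N : ℕ} (H : ℝ → Op N) : Prop where
  selfAdjoint : ∀ s ∈ unitTime, IsSelfAdjoint (H s)
  differentiable : ∀ k < 3, DifferentiableOn ℝ (derivH k H) unitTime
  bounded : BddAbove ((fun s => ‖derivH 3 H s‖) '' unitTime)

/-- The largest value on `[0,1]` of the operator norm of the `k`-th derivative of `H`. -/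
def maxNorm {N : ℕ} (k : ℕ) (H : ℝ → Op N) : ℝ :=
  sSup ((fun s => ‖derivH k H s‖) '' unitTime)

/-- The minimum eigenvalue gap `γ_min`: the infimum of `|a - b|` over all `s ∈ [0,1]` and all pairs
of distinct eigenvalues `a ≠ b` of `H s`. If the eigenvalues vary continuously with `s`, this is
positive only if no two of them cross or touch. -/
def minGap {N : ℕ} (H : ℝ → Op N) : ℝ :=
  sInf {g : ℝ | ∃ s ∈ unitTime, ∃ a b : ℝ,
    Module.End.HasEigenvalue (H s : Ket N →ₗ[ℂ] Ket N) (a : ℂ) ∧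
    Module.End.HasEigenvalue (H s : Ket N →ₗ[ℂ] Ket N) (b : ℂ) ∧
    a ≠ b ∧ g = |a - b|}

/-- The timescale `Δ₁`. -/
def Delta1 {N : ℕ} (H : ℝ → Op N) : ℝ :=
  1 / minGap H * (maxNorm 3 H / minGap H + maxNorm 2 H ^ 3 / minGap H ^ 3
    + maxNorm 1 H ^ 6 / minGap H ^ 6)

/-- `U s` is the time-evolution operator `U(s,0)` of `H` in the dimensionless time `s = t / T`
(with `ħ = 1`): `∂ₛ U = -i T H(s) U` on `[0,1]` and `U 0 = 1`. -/
structure IsEvolution {N : ℕ} (T : ℝ) (H U : ℝ → Op N) : Prop where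
  initial : U 0 = 1
  schrodinger : ∀ s ∈ unitTime,
    HasDerivWithinAt U ((-(Complex.I * (T : ℂ))) • (H s * U s)) unitTime s

/-- The derivative of a differentiable curve of states on `[0,1]`. -/
def dotKet {N : ℕ} (ψ : ℝ → Ket N) (s : ℝ) : Ket N :=
  derivWithin ψ unitTime s

/-- `ψ n s`, `n = 0, …, N-1`, is an orthonormal basis of instantaneous eigenstates of `H s`, with
eigenvalues `E n s`, which is differentiable in `s` and chosen so that `⟨ψ̇ n, ψ m⟩ = 0` for
`n = m` (choice of the phases) and for all pairs `n`, `m` with the same eigenvalue. -/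
structure IsEigenframe {N : ℕ} (H : ℝ → Op N) (E : Fin N → ℝ → ℝ) (ψ : Fin N → ℝ → Ket N) :
    Prop where
  orthonormal : ∀ s ∈ unitTime, Orthonormal ℂ (fun n => ψ n s)
  eigen : ∀ s ∈ unitTime, ∀ n, H s (ψ n s) = (E n s : ℂ) • ψ n s
  differentiable : ∀ n, DifferentiableOn ℝ (ψ n) unitTime
  transport : ∀ s ∈ unitTime, ∀ n m, E n s = E m s → inner ℂ (dotKet (ψ n) s) (ψ m s) = 0

/-- The error in the adiabatic approximation, `(1 - |G(1)⟩⟨G(1)|) U(1,0) |G(0)⟩`. -/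
def adiabaticError {N : ℕ} (U : ℝ → Op N) (ψ : Fin N → ℝ → Ket N) (G : Fin N) : Ket N :=
  U 1 (ψ G 0) - inner ℂ (ψ G 1) (U 1 (ψ G 0)) • ψ G 1

/-- The phase `φ_ν = T ∫₀¹ E_ν(ξ) dξ`. -/
def phase {N : ℕ} (T : ℝ) (E : Fin N → ℝ → ℝ) (ν : Fin N) : ℝ :=
  (∫ ξ in (0 : ℝ)..1, E ν ξ) * T

/-- The signed gap `γ_{G,ν}(s) = E_G(s) - E_ν(s)`. -/
def gap {N : ℕ} (E : Fin N → ℝ → ℝ) (G ν : Fin N) (s : ℝ) : ℝ := E G s - E ν s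

/-- The vector
`∑_{ν ≠ G} e^{-i φ_ν} |ν(1)⟩ ⟨ν̇(s₁)|G(s₁)⟩ e^{-i T ∫₀^{s₁} γ_{G,ν}(ξ) dξ} / (-i γ_{G,ν}(s₁) T)`. -/
def boundarySum {N : ℕ} (T : ℝ) (E : Fin N → ℝ → ℝ) (ψ : Fin N → ℝ → Ket N) (G : Fin N)
    (s₁ : ℝ) : Ket N :=
  ∑ ν ∈ Finset.univ.erase G,
    (Complex.exp (-(Complex.I * (phase T E ν : ℂ))) *
      (inner ℂ (dotKet (ψ ν) s₁) (ψ G s₁) *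
        Complex.exp (-(Complex.I * (((∫ ξ in (0 : ℝ)..s₁, gap E G ν ξ) * T : ℝ) : ℂ))) /
        (-(Complex.I * (gap E G ν s₁ : ℂ) * (T : ℂ))))) • ψ ν 1

/-- The first-order boundary term: the difference of `boundarySum` at `s₁ = 1` and `s₁ = 0`. -/
def boundaryTerm {N : ℕ} (T : ℝ) (E : Fin N → ℝ → ℝ) (ψ : Fin N → ℝ → Ket N) (G : Fin N) :
    Ket N :=
  boundarySum T E ψ G 1 - boundarySum T E ψ G 0

end Adiabatic

end

/-!
The evolved state `U(1,0)|G(0)⟩` is compared with an explicit approximate solution of the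
Schrödinger equation.

After division of the energy by `γ_min` and multiplication of the time scale by it
(`τ = γ_min T`) all gaps are at least `1`. Let `R` be the reduced resolvent at the level `G` and
`b = i R |Ġ⟩`. The curve
`e^{-iτ∫E_G} (|G⟩ + (b + c |G⟩) / τ + (i R ḃ + c b) / τ²)`, with `ċ = ⟨Ġ|b⟩` and `c(0) = 0`, solves the
Schrödinger equation up to a residual of size `1 / τ²`
(`GappedFrame.exists_norm_order_two_le`). As the evolution is unitary, an approximate solution is as
close to the true one as its residual is small (`IsEvolution.norm_sub_le`), so this residual need
only be bounded, and three derivatives of the Hamiltonian suffice. At `s = 1` the part of the curve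
of order `1 / τ` outside `|G⟩` is the boundary term at `s₁ = 1`. At `s = 0` the curve differs from
`|G(0)⟩` by `b(0) / τ` to first order, and the adiabatic theorem of order zero for every frame vector
`|ν⟩` (`GappedFrame.norm_order_zero_le`) carries this difference to the boundary term at `s₁ = 0`.

For the size of the errors, let `x_k` be the supremum of the norm of the `k`-th derivative of the
Hamiltonian divided by `γ_min`, and `D = γ_min Δ₁ = x₃ + x₂³ + x₁⁶`. Since `D` is `0` or bounded
below, there is a rate `ρ` with `x_k ≤ ρ ^ k`, `x₁² ≤ ρ` and `ρ² + ρ³ = O(D)` (`exists_rate`).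
All derivatives of the frame and of the inverse gaps are bounded by powers of `ρ`, with constants
that do not depend on `T`: this is the notion `Tame`, which is closed under products, and the
frame is shown to be tame by bootstrapping the formulas for its first derivatives
(`tame_frame_invGap`). The estimate obtained is `O((ρ² + ρ³) / τ²)`. The single contribution that
powers of `ρ` alone would not control is the one with the coefficient `c`, for which `x₁² ≤ ρ` is
used.
-/

namespace Adiabatic

/-! ### Families with uniformly controlled derivatives -/

section Tame

variable {ι : Type*} {ρ : ι → ℝ}
  {V W X : Type*} [NormedAddCommGroup V] [NormedSpace ℝ V] [NormedAddCommGroup W] [NormedSpace ℝ W]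
  [NormedAddCommGroup X] [NormedSpace ℝ X]

/-- A family of curves `f i` on `[0,1]` is tame of order `k` at the rates `ρ i` if it has `k`
derivatives on `[0,1]`, the `j`-th of which is bounded by a constant times `ρ i ^ j`, uniformly in
the parameter `i`. The derivative is recorded in the form `ρ i • g i`, with `g` tame of order
`k - 1`, so that rates `ρ i = 0` are allowed: the curve is then constant. -/
def Tame (ρ : ι → ℝ) : ℕ → (ι → ℝ → V) → Prop
  | 0, f => ∃ A : ℝ, ∀ i, ∀ s ∈ unitTime, ‖f i s‖ ≤ A
  | k + 1, f => (∃ A : ℝ, ∀ i, ∀ s ∈ unitTime, ‖f i s‖ ≤ A) ∧ ∃ g : ι → ℝ → V,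
      (∀ i, ∀ s ∈ unitTime, HasDerivWithinAt (f i) (ρ i • g i s) unitTime s) ∧ Tame ρ k g

lemma Tame.bound {k : ℕ} {f : ι → ℝ → V} (hf : Tame ρ k f) :
    ∃ A : ℝ, 0 ≤ A ∧ ∀ i, ∀ s ∈ unitTime, ‖f i s‖ ≤ A := by
  have : ∃ A : ℝ, ∀ i, ∀ s ∈ unitTime, ‖f i s‖ ≤ A := by
    cases k with
    | zero => exact hf
    | succ k => exact hf.1
  obtain ⟨A, hA⟩ := this
  exact ⟨max A 0, le_max_right _ _, fun i s hs => (hA i s hs).trans (le_max_left _ _)⟩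

lemma Tame.of_succ {k : ℕ} : ∀ {f : ι → ℝ → V}, Tame ρ (k + 1) f → Tame ρ k f := by
  induction k with
  | zero => exact fun hf => hf.1
  | succ k ih => exact fun hf => ⟨hf.1, hf.2.choose, hf.2.choose_spec.1, ih hf.2.choose_spec.2⟩

lemma Tame.succ {k : ℕ} {f g : ι → ℝ → V} (hf : Tame ρ 0 f)
    (hd : ∀ i, ∀ s ∈ unitTime, HasDerivWithinAt (f i) (ρ i • g i s) unitTime s)
    (hg : Tame ρ k g) : Tame ρ (k + 1) f :=
  ⟨hf, g, hd, hg⟩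

lemma Tame.continuousOn {k : ℕ} {f : ι → ℝ → V} (hf : Tame ρ (k + 1) f) (i : ι) :
    ContinuousOn (f i) unitTime := fun s hs => by
  obtain ⟨_, g, hg, _⟩ := hf
  exact (hg i s hs).continuousWithinAt

lemma Tame.add {k : ℕ} : ∀ {f g : ι → ℝ → V}, Tame ρ k f → Tame ρ k g →
    Tame ρ k (fun i s => f i s + g i s) := by
  have h0 : ∀ {f g : ι → ℝ → V}, Tame ρ 0 f → Tame ρ 0 g → Tame ρ 0 (fun i s => f i s + g i s) := by
    rintro f g ⟨A, hA⟩ ⟨B, hB⟩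
    exact ⟨A + B, fun i s hs => (norm_add_le _ _).trans (add_le_add (hA i s hs) (hB i s hs))⟩
  induction k with
  | zero => exact h0
  | succ k ih =>
    rintro f g ⟨hf, f', hf', hf''⟩ ⟨hg, g', hg', hg''⟩
    refine (h0 hf hg).succ (g := fun i s => f' i s + g' i s) (fun i s hs => ?_) (ih hf'' hg'')
    rw [smul_add]
    exact (hf' i s hs).add (hg' i s hs)

lemma Tame.zero (k : ℕ) : Tame ρ k (fun _ _ => (0 : V)) := by
  induction k with
  | zero => exact ⟨0, by simp⟩
  | succ k ih =>
    refine Tame.succ ⟨0, by simp⟩ (fun i s _ => ?_) ih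
    rw [smul_zero]
    exact hasDerivWithinAt_const _ _ _

lemma Tame.const (k : ℕ) (v : V) : Tame ρ k (fun _ _ => v) := by
  cases k with
  | zero => exact ⟨‖v‖, by simp⟩
  | succ k =>
    refine Tame.succ ⟨‖v‖, by simp⟩ (fun i s _ => ?_) (Tame.zero k)
    rw [smul_zero]
    exact hasDerivWithinAt_const _ _ _

lemma Tame.sum {k : ℕ} {α : Type*} (S : Finset α) {f : α → ι → ℝ → V}
    (hf : ∀ a, Tame ρ k (f a)) : Tame ρ k (fun i s => ∑ a ∈ S, f a i s) := by
  classical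
  induction S using Finset.induction_on with
  | empty => simpa using Tame.zero k
  | insert a S ha ih =>
    simp only [Finset.sum_insert ha]
    exact (hf a).add ih

/-- Tame families are closed under products of every kind, by the Leibniz rule. -/
lemma Tame.bilin {k : ℕ} {b : V × W → X} (hb : IsBoundedBilinearMap ℝ b) :
    ∀ {f : ι → ℝ → V} {g : ι → ℝ → W}, Tame ρ k f → Tame ρ k g →
    Tame ρ k (fun i s => b (f i s, g i s)) := by
  have h0 : ∀ {f : ι → ℝ → V} {g : ι → ℝ → W}, Tame ρ 0 f → Tame ρ 0 g →
      Tame ρ 0 (fun i s => b (f i s, g i s)) := by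
    intro f g hf hg
    obtain ⟨A, hA0, hA⟩ := hf.bound
    obtain ⟨B, hB0, hB⟩ := hg.bound
    obtain ⟨C, hC0, hC⟩ := hb.bound
    refine ⟨C * A * B, fun i s hs => (hC _ _).trans ?_⟩
    have := hA i s hs
    have := hB i s hs
    gcongr
  induction k with
  | zero => exact h0
  | succ k ih =>
    intro f g hf hg
    have hf1 := hf.of_succ
    have hg1 := hg.of_succ
    obtain ⟨hf, f', hf', hf''⟩ := hf
    obtain ⟨hg, g', hg', hg''⟩ := hg
    refine (h0 hf hg).succ (g := fun i s => b (f i s, g' i s) + b (f' i s, g i s))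
      (fun i s hs => ?_) ((ih hf1 hg'').add (ih hf'' hg1))
    have h := (hb.hasFDerivAt (f i s, g i s)).comp_hasDerivWithinAt s
      ((hf' i s hs).prodMk (hg' i s hs))
    rw [smul_add, ← hb.smul_right, ← hb.smul_left]
    exact h

end Tame

lemma Tame.cmul {ι : Type*} {ρ : ι → ℝ} {k : ℕ} {f g : ι → ℝ → ℂ} (hf : Tame ρ k f)
    (hg : Tame ρ k g) : Tame ρ k (fun i s => f i s * g i s) :=
  Tame.bilin (isBoundedBilinearMap_mul (𝕜 := ℝ) (A := ℂ)) hf hg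

lemma Tame.csmul {ι : Type*} {ρ : ι → ℝ} {N k : ℕ} {f : ι → ℝ → ℂ} {g : ι → ℝ → Ket N}
    (hf : Tame ρ k f) (hg : Tame ρ k g) : Tame ρ k (fun i s => f i s • g i s) :=
  Tame.bilin (b := fun p : ℂ × Ket N => p.1 • p.2)
    (isBoundedBilinearMap_smul (𝕜 := ℝ) (A := ℂ) (E := Ket N)) hf hg

/-- The operator application is bilinear over `ℝ`. -/
lemma isBoundedBilinearMap_op_apply (N : ℕ) :
    IsBoundedBilinearMap ℝ (fun p : Op N × Ket N => p.1 p.2) where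
  add_left := by simp
  smul_left := by simp
  add_right := by simp
  smul_right := by
    intro c A v
    simp
  bound := ⟨1, one_pos, fun A v => by simpa using A.le_opNorm v⟩

lemma Tame.apply {ι : Type*} {ρ : ι → ℝ} {N k : ℕ} {f : ι → ℝ → Op N} {g : ι → ℝ → Ket N}
    (hf : Tame ρ k f) (hg : Tame ρ k g) : Tame ρ k (fun i s => f i s (g i s)) :=
  Tame.bilin (isBoundedBilinearMap_op_apply N) hf hg

lemma Tame.inner {ι : Type*} {ρ : ι → ℝ} {N k : ℕ} {f g : ι → ℝ → Ket N}
    (hf : Tame ρ k f) (hg : Tame ρ k g) : Tame ρ k (fun i s => inner ℂ (f i s) (g i s)) :=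
  Tame.bilin (isBoundedBilinearMap_inner (𝕜 := ℂ) (E := Ket N)) hf hg

end Adiabatic

namespace Adiabatic

/-! ### Derivatives of an eigenframe -/

variable {N : ℕ}

lemma HasDerivWithinAt.op_apply {A : ℝ → Op N} {v : ℝ → Ket N} {A' : Op N} {v' : Ket N}
    {S : Set ℝ} {s : ℝ} (hA : HasDerivWithinAt A A' S s) (hv : HasDerivWithinAt v v' S s) :
    HasDerivWithinAt (fun u => A u (v u)) (A s v' + A' (v s)) S s := by
  have h := ((isBoundedBilinearMap_op_apply N).hasFDerivAt (A s, v s)).comp_hasDerivWithinAt s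
    (hA.prodMk hv)
  exact h

lemma uniqueDiffWithinAt_unitTime {s : ℝ} (hs : s ∈ unitTime) :
    UniqueDiffWithinAt ℝ unitTime s :=
  uniqueDiffOn_Icc zero_lt_one s hs

/-- A Hamiltonian whose distinct eigenvalues are at distance at least `1`, with an eigenframe, and
with its derivative written as `r • k`. -/
structure GappedFrame (K : ℝ → Op N) (r : ℝ) (k : ℝ → Op N) (e : Fin N → ℝ → ℝ)
    (ψ : Fin N → ℝ → Ket N) : Prop where
  selfAdjoint : ∀ s ∈ unitTime, IsSelfAdjoint (K s)
  hasDeriv : ∀ s ∈ unitTime, HasDerivWithinAt K (r • k s) unitTime s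
  frame : IsEigenframe K e ψ
  one_le_gap : ∀ s ∈ unitTime, ∀ n m, e n s ≠ e m s → 1 ≤ |e n s - e m s|

/-- The inverse gap `1 / (e_m - e_n)`. Where the two eigenvalues agree it is `0` because of
`0⁻¹ = 0`, so that `∑ m, invGap e n m s • |m⟩⟨m|` is the reduced resolvent at `e_n`. -/
noncomputable def invGap (e : Fin N → ℝ → ℝ) (n m : Fin N) (s : ℝ) : ℂ :=
  ((e m s : ℂ) - (e n s : ℂ))⁻¹

/-- The matrix element `⟨m| k |n⟩`. -/
noncomputable def coupling (k : ℝ → Op N) (ψ : Fin N → ℝ → Ket N) (n m : Fin N) (s : ℝ) : ℂ :=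
  inner ℂ (ψ m s) (k s (ψ n s))

/-- The velocity of the `n`-th frame vector, up to the factor `r`: the reduced resolvent
at `e_n`, applied to `-k |n⟩`. -/
noncomputable def frameVel (k : ℝ → Op N) (e : Fin N → ℝ → ℝ) (ψ : Fin N → ℝ → Ket N) (n : Fin N)
    (s : ℝ) : Ket N :=
  ∑ m, (-1 * (invGap e n m s * coupling k ψ n m s)) • ψ m s

/-- The coefficient of `|m⟩` in the first-order adiabatic correction to `|n⟩`. -/
noncomputable def corrCoeff (k : ℝ → Op N) (e : Fin N → ℝ → ℝ) (ψ : Fin N → ℝ → Ket N)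
    (n m : Fin N) (s : ℝ) : ℂ :=
  -Complex.I * (invGap e n m s * invGap e n m s * coupling k ψ n m s)

/-- The first-order adiabatic correction to the `n`-th frame vector, up to the factor `r / τ`:
the square of the reduced resolvent at `e_n`, applied to `-i k |n⟩`. -/
noncomputable def firstCorr (k : ℝ → Op N) (e : Fin N → ℝ → ℝ) (ψ : Fin N → ℝ → Ket N)
    (n : Fin N) (s : ℝ) : Ket N :=
  ∑ m, corrCoeff k e ψ n m s • ψ m s

/-- The second-order adiabatic correction to the `n`-th frame vector, up to the factor `(r / τ)²`
and a multiple of the first-order one: `i` times the reduced resolvent at `e_n`, applied to the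
derivative `r • v` of the first-order correction (without the factor `r`). -/
noncomputable def secondCorr (e : Fin N → ℝ → ℝ) (ψ : Fin N → ℝ → Ket N) (v : ℝ → Ket N)
    (n : Fin N) (s : ℝ) : Ket N :=
  ∑ m, (Complex.I * (invGap e n m s * inner ℂ (ψ m s) (v s))) • ψ m s

namespace GappedFrame

variable {K : ℝ → Op N} {r : ℝ} {k : ℝ → Op N} {e : Fin N → ℝ → ℝ} {ψ : Fin N → ℝ → Ket N}
  (h : GappedFrame K r k e ψ) {s : ℝ}

include h

lemma expansion (hs : s ∈ unitTime) (v : Ket N) :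
    ∑ m, (inner ℂ (ψ m s) v : ℂ) • ψ m s = v := by
  have ho := h.frame.orthonormal s hs
  rcases isEmpty_or_nonempty (Fin N) with _ | _
  · exact Subsingleton.elim _ _
  let b := basisOfOrthonormalOfCardEqFinrank ho (by simp)
  have hb : ⇑b = fun n => ψ n s := coe_basisOfOrthonormalOfCardEqFinrank ho (by simp)
  let B := b.toOrthonormalBasis (by rw [hb]; exact ho)
  have hB : ∀ m, B m = ψ m s := fun m => by
    rw [Module.Basis.coe_toOrthonormalBasis, hb]
  simpa only [hB] using B.sum_repr' v

lemma inner_frame (hs : s ∈ unitTime) (n m : Fin N) :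
    (inner ℂ (ψ n s) (ψ m s) : ℂ) = if n = m then 1 else 0 :=
  orthonormal_iff_ite.mp (h.frame.orthonormal s hs) n m

lemma norm_frame (hs : s ∈ unitTime) (n : Fin N) : ‖ψ n s‖ = 1 :=
  (h.frame.orthonormal s hs).1 n

lemma inner_op (hs : s ∈ unitTime) (m : Fin N) (v : Ket N) :
    (inner ℂ (ψ m s) (K s v) : ℂ) = e m s * inner ℂ (ψ m s) v := by
  have hsym : (inner ℂ (K s (ψ m s)) v : ℂ) = inner ℂ (ψ m s) (K s v) :=
    (ContinuousLinearMap.isSelfAdjoint_iff_isSymmetric.mp (h.selfAdjoint s hs)) (ψ m s) v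
  rw [← hsym, h.frame.eigen s hs m, inner_smul_left, Complex.conj_ofReal]

lemma hasDeriv_dotKet (hs : s ∈ unitTime) (n : Fin N) :
    HasDerivWithinAt (ψ n) (dotKet (ψ n) s) unitTime s :=
  (h.frame.differentiable n s hs).hasDerivWithinAt

lemma hasDeriv_energy (hs : s ∈ unitTime) (n : Fin N) :
    HasDerivWithinAt (fun u => (e n u : ℂ)) (r • coupling k ψ n n s) unitTime s := by
  have h1 := h.hasDeriv_dotKet hs n
  have h2 := h1.inner ℂ (HasDerivWithinAt.op_apply (h.hasDeriv s hs) h1)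
  have h3 : (inner ℂ (dotKet (ψ n) s) (ψ n s) : ℂ) = 0 := h.frame.transport s hs n n rfl
  have h3' : (inner ℂ (ψ n s) (dotKet (ψ n) s) : ℂ) = 0 := by
    rw [← inner_conj_symm, h3, map_zero]
  have hval : ∀ u ∈ unitTime, (e n u : ℂ) = inner ℂ (ψ n u) (K u (ψ n u)) := fun u hu => by
    rw [h.inner_op hu, h.inner_frame hu, if_pos rfl, mul_one]
  refine (h2.congr hval (hval s hs)).congr_deriv ?_
  rw [inner_add_right, h.inner_op hs, h.frame.eigen s hs n, inner_smul_right, h3, h3']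
  simp [coupling, inner_smul_right_eq_smul]

lemma inner_frame_dotKet (hs : s ∈ unitTime) (n m : Fin N) :
    (inner ℂ (ψ m s) (dotKet (ψ n) s) : ℂ) = r • (-1 * (invGap e n m s * coupling k ψ n m s)) := by
  by_cases hnm : e n s = e m s
  · rw [← inner_conj_symm, h.frame.transport s hs n m hnm]
    simp [invGap, hnm]
  · have h1 := h.hasDeriv_dotKet hs n
    have h2 := HasDerivWithinAt.op_apply (h.hasDeriv s hs) h1
    have h3 := (h.hasDeriv_energy hs n).smul h1
    have h4 := h3.congr (fun u hu => h.frame.eigen u hu n) (h.frame.eigen s hs n)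
    have h5 := congrArg (fun v => (inner ℂ (ψ m s) v : ℂ))
      ((uniqueDiffWithinAt_unitTime hs).eq_deriv _ h2 h4)
    have hne : m ≠ n := by rintro rfl; exact hnm rfl
    have hsub : (e m s : ℂ) - e n s ≠ 0 := by
      rw [sub_ne_zero]; exact_mod_cast Ne.symm hnm
    simp only [inner_add_right, h.inner_op hs, inner_smul_right, h.inner_frame hs, if_neg hne,
      mul_zero, add_zero, smul_apply, inner_smul_right_eq_smul] at h5
    change _ + r • coupling k ψ n m s = _ at h5
    rw [invGap]
    simp only [Complex.real_smul] at h5 ⊢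
    field_simp
    linear_combination h5

lemma hasDeriv_frame (hs : s ∈ unitTime) (n : Fin N) :
    HasDerivWithinAt (ψ n) (r • frameVel k e ψ n s) unitTime s := by
  refine (h.hasDeriv_dotKet hs n).congr_deriv ?_
  rw [← h.expansion hs (dotKet (ψ n) s), frameVel, Finset.smul_sum]
  simp only [h.inner_frame_dotKet hs, smul_assoc]

lemma norm_invGap_le (hs : s ∈ unitTime) (n m : Fin N) : ‖invGap e n m s‖ ≤ 1 := by
  by_cases hnm : e m s = e n s
  · simp [invGap, hnm]
  · rw [invGap, norm_inv, ← Complex.ofReal_sub, Complex.norm_real]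
    exact inv_le_one_of_one_le₀ (h.one_le_gap s hs m n hnm)

lemma hasDeriv_invGap (hs : s ∈ unitTime) (n m : Fin N) :
    HasDerivWithinAt (invGap e n m) (r • (-1 * (invGap e n m s * invGap e n m s) *
      (coupling k ψ m m s + -1 * coupling k ψ n n s))) unitTime s := by
  have hd := (h.hasDeriv_energy hs m).sub (h.hasDeriv_energy hs n)
  by_cases hnm : e m s = e n s
  · -- by the gap, eigenvalues which agree at `s` agree near `s`
    have hc := hd.continuousWithinAt
    have hlt : ∀ᶠ u in 𝓝[unitTime] s, ‖(e m u : ℂ) - e n u‖ < 1 := by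
      refine hc.norm.eventually_lt_const ?_
      simp [hnm]
    have hz : ∀ᶠ u in 𝓝[unitTime] s, invGap e n m u = 0 := by
      filter_upwards [hlt, self_mem_nhdsWithin] with u hu hu'
      rw [invGap, inv_eq_zero]
      by_contra hne
      rw [← Complex.ofReal_sub, Complex.norm_real] at hu
      refine absurd (h.one_le_gap u hu' m n fun hh => hne ?_) (not_le.mpr hu)
      rw [hh, sub_self]
    have hs0 : invGap e n m s = 0 := by simp [invGap, hnm]
    rw [hs0]
    simpa using (hasDerivWithinAt_const s unitTime (0 : ℂ)).congr_of_eventuallyEq hz hs0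
  · have hsub : (e m s : ℂ) - e n s ≠ 0 := by
      rw [sub_ne_zero]; exact_mod_cast hnm
    refine (hd.inv hsub).congr_deriv ?_
    simp only [invGap, Complex.real_smul, Pi.sub_apply]
    field_simp
    ring

lemma norm_sum_frame_le (hs : s ∈ unitTime) (c : Fin N → ℂ) {A : ℝ} (hc : ∀ m, ‖c m‖ ≤ A) :
    ‖∑ m, c m • ψ m s‖ ≤ N * A := by
  refine (norm_sum_le _ _).trans ?_
  calc ∑ m, ‖c m • ψ m s‖ ≤ ∑ _m : Fin N, A :=
        Finset.sum_le_sum fun m _ => by rw [norm_smul, h.norm_frame hs, mul_one]; exact hc m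
    _ = N * A := by simp

lemma norm_coupling_le (hs : s ∈ unitTime) (n m : Fin N) : ‖coupling k ψ n m s‖ ≤ ‖k s‖ := by
  refine (norm_inner_le_norm _ _).trans ?_
  rw [h.norm_frame hs, one_mul]
  simpa [h.norm_frame hs] using (k s).le_opNorm (ψ n s)

lemma norm_frameVel_le (hs : s ∈ unitTime) (n : Fin N) : ‖frameVel k e ψ n s‖ ≤ N * ‖k s‖ := by
  refine h.norm_sum_frame_le hs _ fun m => ?_
  rw [norm_mul, norm_mul, norm_neg, norm_one, one_mul]
  exact (mul_le_mul (h.norm_invGap_le hs n m) (h.norm_coupling_le hs n m) (norm_nonneg _)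
    zero_le_one).trans_eq (one_mul _)

lemma norm_corrCoeff_le (hs : s ∈ unitTime) (n m : Fin N) : ‖corrCoeff k e ψ n m s‖ ≤ ‖k s‖ := by
  rw [corrCoeff, norm_mul, norm_mul, norm_mul, norm_neg, Complex.norm_I, one_mul]
  have h1 := h.norm_invGap_le hs n m
  have h2 := h.norm_coupling_le hs n m
  calc _ ≤ 1 * 1 * ‖k s‖ := by gcongr
    _ = ‖k s‖ := by ring

lemma norm_firstCorr_le (hs : s ∈ unitTime) (n : Fin N) :
    ‖firstCorr k e ψ n s‖ ≤ N * ‖k s‖ :=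
  h.norm_sum_frame_le hs _ fun m => h.norm_corrCoeff_le hs n m

/-- The first-order correction solves `i (K - e_n) b = -ψ̇_n`, which cancels the leading error of
the instantaneous eigenstate. -/
lemma op_firstCorr (hs : s ∈ unitTime) (n : Fin N) :
    K s (firstCorr k e ψ n s) =
      (e n s : ℂ) • firstCorr k e ψ n s + Complex.I • frameVel k e ψ n s := by
  rw [firstCorr, frameVel, map_sum, Finset.smul_sum, Finset.smul_sum, ← Finset.sum_add_distrib]
  refine Finset.sum_congr rfl fun m _ => ?_
  rw [map_smul, h.frame.eigen s hs m, smul_smul, smul_smul, smul_smul, ← add_smul]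
  congr 1
  rw [corrCoeff]
  by_cases hnm : e m s = e n s
  · simp [invGap, hnm]
  · have hsub : (e m s : ℂ) - e n s ≠ 0 := by
      rw [sub_ne_zero]; exact_mod_cast hnm
    rw [invGap]
    field_simp
    ring

lemma inner_sum_frame (hs : s ∈ unitTime) (c : Fin N → ℂ) (n : Fin N) :
    (inner ℂ (ψ n s) (∑ m, c m • ψ m s) : ℂ) = c n := by
  simp [h.inner_frame hs]

lemma inner_firstCorr_self (hs : s ∈ unitTime) (n : Fin N) :
    (inner ℂ (ψ n s) (firstCorr k e ψ n s) : ℂ) = 0 := by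
  rw [firstCorr, h.inner_sum_frame hs]
  simp [corrCoeff, invGap]

/-- For a non-degenerate level, the second-order correction solves
`i (K - e_n) a = -(1 - |n⟩⟨n|) v`. -/
lemma op_secondCorr (hs : s ∈ unitTime) {n : Fin N} (hn : ∀ m, m ≠ n → e m s ≠ e n s)
    (v : ℝ → Ket N) :
    K s (secondCorr e ψ v n s) = (e n s : ℂ) • secondCorr e ψ v n s +
      Complex.I • (v s - (inner ℂ (ψ n s) (v s) : ℂ) • ψ n s) := by
  have hv : v s - (inner ℂ (ψ n s) (v s) : ℂ) • ψ n s =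
      ∑ m, (if m = n then 0 else (inner ℂ (ψ m s) (v s) : ℂ)) • ψ m s := by
    refine (h.expansion hs _).symm.trans (Finset.sum_congr rfl fun m _ => ?_)
    congr 1
    rw [inner_sub_right, inner_smul_right, h.inner_frame hs]
    split_ifs with hmn <;> simp [hmn]
  rw [hv, secondCorr, map_sum, Finset.smul_sum, Finset.smul_sum, ← Finset.sum_add_distrib]
  refine Finset.sum_congr rfl fun m _ => ?_
  rw [map_smul, h.frame.eigen s hs m, smul_smul, smul_smul, smul_smul, ← add_smul]
  congr 1
  by_cases hnm : m = n
  · simp [invGap, hnm]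
  · have hsub : (e m s : ℂ) - e n s ≠ 0 := by
      rw [sub_ne_zero]; exact_mod_cast hn m hnm
    rw [invGap, if_neg hnm]
    field_simp
    ring

end GappedFrame

/-! ### Regularity of the frame, uniformly in a parameter -/

section Bootstrap

variable {ι : Type*} {ρ : ι → ℝ} {K k : ι → ℝ → Op N} {e : ι → Fin N → ℝ → ℝ}
  {ψ : ι → Fin N → ℝ → Ket N}

lemma tame_coupling {j : ℕ} (hk : Tame ρ j k) (hψ : ∀ n, Tame ρ j (fun i => ψ i n)) (n m : Fin N) :
    Tame ρ j (fun i => coupling (k i) (ψ i) n m) :=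
  (hψ m).inner (hk.apply (hψ n))

lemma tame_frameVel {j : ℕ} (hk : Tame ρ j k) (hψ : ∀ n, Tame ρ j (fun i => ψ i n))
    (hw : ∀ n m, Tame ρ j (fun i => invGap (e i) n m)) (n : Fin N) :
    Tame ρ j (fun i => frameVel (k i) (e i) (ψ i) n) :=
  Tame.sum _ fun m => ((Tame.const j (-1)).cmul ((hw n m).cmul (tame_coupling hk hψ n m))).csmul
    (hψ m)

/-- The frame and the inverse gaps inherit the regularity of the Hamiltonian: their derivatives are
polynomials in `k`, the frame and the inverse gaps, so that each derivative of these yields one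
more. -/
lemma tame_frame_invGap (h : ∀ i, GappedFrame (K i) (ρ i) (k i) (e i) (ψ i)) {j : ℕ}
    (hk : Tame ρ j k) :
    (∀ n, Tame ρ (j + 1) (fun i => ψ i n)) ∧ ∀ n m, Tame ρ (j + 1) (fun i => invGap (e i) n m) := by
  have hψ0 : ∀ n, Tame ρ 0 (fun i => ψ i n) := fun n =>
    ⟨1, fun i s hs => ((h i).norm_frame hs n).le⟩
  have hw0 : ∀ n m, Tame ρ 0 (fun i => invGap (e i) n m) := fun n m =>
    ⟨1, fun i s hs => (h i).norm_invGap_le hs n m⟩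
  have step : ∀ l, Tame ρ l k → (∀ n, Tame ρ l (fun i => ψ i n)) →
      (∀ n m, Tame ρ l (fun i => invGap (e i) n m)) →
      (∀ n, Tame ρ (l + 1) (fun i => ψ i n)) ∧
        ∀ n m, Tame ρ (l + 1) (fun i => invGap (e i) n m) := by
    intro l hk hψ hw
    have hV := tame_coupling hk hψ
    refine ⟨fun n => (hψ0 n).succ (fun i s hs => (h i).hasDeriv_frame hs n)
        (tame_frameVel hk hψ hw n),
      fun n m => (hw0 n m).succ (fun i s hs => (h i).hasDeriv_invGap hs n m) ?_⟩
    exact ((Tame.const l (-1)).cmul ((hw n m).cmul (hw n m))).cmul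
      ((hV m m).add ((Tame.const l (-1)).cmul (hV n n)))
  induction j with
  | zero => exact step 0 hk hψ0 hw0
  | succ j ih => exact step _ hk (ih hk.of_succ).1 (ih hk.of_succ).2

lemma tame_firstCorr {j : ℕ} (hk : Tame ρ j k) (hψ : ∀ n, Tame ρ j (fun i => ψ i n))
    (hw : ∀ n m, Tame ρ j (fun i => invGap (e i) n m)) (n : Fin N) :
    Tame ρ j (fun i => firstCorr (k i) (e i) (ψ i) n) :=
  Tame.sum _ fun m => ((Tame.const j (-Complex.I)).cmul
    (((hw n m).cmul (hw n m)).cmul (tame_coupling hk hψ n m))).csmul (hψ m)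

lemma tame_secondCorr {j : ℕ} {v : ι → ℝ → Ket N} (hv : Tame ρ j v)
    (hψ : ∀ n, Tame ρ j (fun i => ψ i n)) (hw : ∀ n m, Tame ρ j (fun i => invGap (e i) n m))
    (n : Fin N) : Tame ρ j (fun i => secondCorr (e i) (ψ i) (v i) n) :=
  Tame.sum _ fun m => ((Tame.const j Complex.I).cmul
    ((hw n m).cmul ((hψ m).inner hv))).csmul (hψ m)

end Bootstrap

end Adiabatic

namespace Adiabatic

/-! ### Stability of the Schrödinger evolution -/

variable {N : ℕ}

lemma real_smul_ket (r : ℝ) (v : Ket N) : r • v = (r : ℂ) • v :=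
  RCLike.real_smul_eq_coe_smul (K := ℂ) r v

lemma hasDerivWithinAt_primitive {F : Type*} [NormedAddCommGroup F] [NormedSpace ℝ F]
    [CompleteSpace F] {f : ℝ → F} (hf : ContinuousOn f unitTime) {s : ℝ} (hs : s ∈ unitTime) :
    HasDerivWithinAt (fun u => ∫ ξ in (0 : ℝ)..u, f ξ) (f s) unitTime s := by
  have : Fact (s ∈ Icc (0 : ℝ) 1) := ⟨hs⟩
  have hsub : uIcc 0 s ⊆ unitTime := by
    rw [uIcc_of_le hs.1]
    exact Icc_subset_Icc_right hs.2
  exact intervalIntegral.integral_hasDerivWithinAt_right ((hf.mono hsub).intervalIntegrable)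
    (hf.stronglyMeasurableAtFilter_nhdsWithin measurableSet_Icc s) (hf s hs)

namespace IsEvolution

variable {τ : ℝ} {K U : ℝ → Op N} (hU : IsEvolution τ K U)
  (hK : ∀ s ∈ unitTime, IsSelfAdjoint (K s))

include hU hK

lemma hasDeriv_star {s : ℝ} (hs : s ∈ unitTime) :
    HasDerivWithinAt (fun u => star (U u)) ((Complex.I * (τ : ℂ)) • (star (U s) * K s))
      unitTime s := by
  refine (hU.schrodinger s hs).star.congr_deriv ?_
  rw [star_smul, star_mul, (hK s hs).star_eq]
  congr 1
  simp

lemma star_mul_self {s : ℝ} (hs : s ∈ unitTime) : star (U s) * U s = 1 := by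
  have hd : ∀ u ∈ unitTime, HasDerivWithinAt (fun u => star (U u) * U u) 0 unitTime u := by
    intro u hu
    refine ((hU.hasDeriv_star hK hu).mul (hU.schrodinger u hu)).congr_deriv ?_
    rw [smul_mul_assoc, mul_smul_comm, mul_assoc]
    module
  have h := (convex_Icc (0 : ℝ) 1).norm_image_sub_le_of_norm_hasDerivWithin_le (C := 0) hd
    (by simp) (left_mem_Icc.mpr zero_le_one) hs
  rw [zero_mul, norm_le_zero_iff, sub_eq_zero] at h
  rw [h, hU.initial, star_one, one_mul]

lemma mul_star_self {s : ℝ} (hs : s ∈ unitTime) : U s * star (U s) = 1 := by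
  have h := congrArg (fun A : Op N => (A : Ket N →ₗ[ℂ] Ket N)) (hU.star_mul_self hK hs)
  have h' := (mul_eq_one_comm (a := ((star (U s) : Op N) : Ket N →ₗ[ℂ] Ket N))
    (b := (U s : Ket N →ₗ[ℂ] Ket N))).mp h
  exact ContinuousLinearMap.coe_injective h'

lemma norm_apply {s : ℝ} (hs : s ∈ unitTime) (v : Ket N) : ‖U s v‖ = ‖v‖ := by
  have h : (inner ℂ (U s v) (U s v) : ℂ) = inner ℂ v v := by
    rw [← ContinuousLinearMap.adjoint_inner_right, ← ContinuousLinearMap.star_eq_adjoint,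
      ← mul_apply_eq_comp, hU.star_mul_self hK hs, one_apply_eq_self]
  rw [inner_self_eq_norm_sq_to_K, inner_self_eq_norm_sq_to_K] at h
  exact (sq_eq_sq₀ (norm_nonneg _) (norm_nonneg _)).mp (by exact_mod_cast h)

lemma norm_star_apply {s : ℝ} (hs : s ∈ unitTime) (v : Ket N) : ‖star (U s) v‖ = ‖v‖ := by
  rw [← hU.norm_apply hK hs, ← mul_apply_eq_comp, hU.mul_star_self hK hs,
    one_apply_eq_self]

/-- An approximate solution of the Schrödinger equation stays close to the true one, because the
evolution is unitary. The residual is only required to be bounded. -/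
lemma norm_sub_le {Φ R : ℝ → Ket N} {ε : ℝ}
    (hΦ : ∀ s ∈ unitTime,
      HasDerivWithinAt Φ (-(Complex.I * (τ : ℂ)) • K s (Φ s) + R s) unitTime s)
    (hR : ∀ s ∈ unitTime, ‖R s‖ ≤ ε) : ‖Φ 1 - U 1 (Φ 0)‖ ≤ ε := by
  have hd : ∀ s ∈ unitTime,
      HasDerivWithinAt (fun u => star (U u) (Φ u)) (star (U s) (R s)) unitTime s := by
    intro s hs
    refine (HasDerivWithinAt.op_apply (hU.hasDeriv_star hK hs) (hΦ s hs)).congr_deriv ?_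
    rw [map_add, map_smul, smul_apply, mul_apply_eq_comp]
    module
  have h1 : (1 : ℝ) ∈ unitTime := right_mem_Icc.mpr zero_le_one
  have h := (convex_Icc (0 : ℝ) 1).norm_image_sub_le_of_norm_hasDerivWithin_le (C := ε) hd
    (fun s hs => by rw [hU.norm_star_apply hK hs]; exact hR s hs)
    (left_mem_Icc.mpr zero_le_one) h1
  rw [hU.initial, star_one, one_apply_eq_self, sub_zero, norm_one, mul_one,
    ← hU.norm_apply hK h1, map_sub, ← mul_apply_eq_comp, hU.mul_star_self hK h1,
    one_apply_eq_self] at h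
  exact h

end IsEvolution

/-! ### The adiabatic theorem of order zero -/

/-- The dynamical phase factor `exp (-i τ ∫₀ˢ e)`. -/
noncomputable def phaseFactor (τ : ℝ) (e : ℝ → ℝ) (s : ℝ) : ℂ :=
  Complex.exp (-(Complex.I * (((∫ ξ in (0 : ℝ)..s, e ξ) * τ : ℝ) : ℂ)))

lemma norm_phaseFactor (τ : ℝ) (e : ℝ → ℝ) (s : ℝ) : ‖phaseFactor τ e s‖ = 1 := by
  rw [phaseFactor, ← mul_neg, ← Complex.ofReal_neg, mul_comm, Complex.norm_exp_ofReal_mul_I]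

lemma hasDerivWithinAt_phaseFactor {τ : ℝ} {e : ℝ → ℝ} (he : ContinuousOn e unitTime) {s : ℝ}
    (hs : s ∈ unitTime) : HasDerivWithinAt (phaseFactor τ e)
      (-(Complex.I * τ * e s) * phaseFactor τ e s) unitTime s := by
  have h := ((((hasDerivWithinAt_primitive he hs).mul_const τ).ofReal_comp).const_mul
    Complex.I).neg.cexp
  refine h.congr_deriv ?_
  simp only [phaseFactor, Pi.neg_apply]
  push_cast
  ring

namespace GappedFrame

variable {K : ℝ → Op N} {r : ℝ} {k : ℝ → Op N} {e : Fin N → ℝ → ℝ} {ψ : Fin N → ℝ → Ket N}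
  (h : GappedFrame K r k e ψ)

include h

lemma continuousOn_energy (n : Fin N) : ContinuousOn (e n) unitTime := by
  have : ContinuousOn (fun u => (e n u : ℂ)) unitTime := fun s hs =>
    (h.hasDeriv_energy hs n).continuousWithinAt
  exact Complex.continuous_re.comp_continuousOn this

/-- If `χ` solves the Schrödinger equation in the frame rotating with the phase of `e_n` up to an
error `ε`, then the rotated `χ` is close to the true evolution. -/
lemma norm_rotated_sub_le {τ ε : ℝ} {U : ℝ → Op N} (hU : IsEvolution τ K U) (n : Fin N)
    {χ χ' : ℝ → Ket N} (hχ : ∀ s ∈ unitTime, HasDerivWithinAt χ (χ' s) unitTime s)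
    (hε : ∀ s ∈ unitTime,
      ‖χ' s + (Complex.I * (τ : ℂ)) • (K s (χ s) - (e n s : ℂ) • χ s)‖ ≤ ε) :
    ‖phaseFactor τ (e n) 1 • χ 1 - U 1 (χ 0)‖ ≤ ε := by
  have h0 : phaseFactor τ (e n) 0 = 1 := by simp [phaseFactor]
  have := hU.norm_sub_le h.selfAdjoint (Φ := fun s => phaseFactor τ (e n) s • χ s)
    (R := fun s => phaseFactor τ (e n) s •
      (χ' s + (Complex.I * (τ : ℂ)) • (K s (χ s) - (e n s : ℂ) • χ s))) (ε := ε)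
    (fun s hs => by
      refine ((hasDerivWithinAt_phaseFactor (h.continuousOn_energy n) hs).smul
        (hχ s hs)).congr_deriv ?_
      rw [map_smul]
      module)
    (fun s hs => by rw [norm_smul, norm_phaseFactor, one_mul]; exact hε s hs)
  simpa only [h0, one_smul] using this

/-- The adiabatic theorem of order zero, with an error of order `1 / τ`. -/
lemma norm_order_zero_le {τ B : ℝ} (hτ : 0 < τ) (hr : 0 ≤ r) {U : ℝ → Op N}
    (hU : IsEvolution τ K U) (n : Fin N) {β' : ℝ → Ket N}
    (hβ : ∀ s ∈ unitTime, HasDerivWithinAt (firstCorr k e ψ n) (r • β' s) unitTime s)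
    (hB : ∀ s ∈ unitTime, ‖firstCorr k e ψ n s‖ ≤ B) (hB' : ∀ s ∈ unitTime, ‖β' s‖ ≤ B) :
    ‖U 1 (ψ n 0) - phaseFactor τ (e n) 1 • ψ n 1‖ ≤ 2 * B * (r + r ^ 2) / τ := by
  have hτ' : (τ : ℂ) ≠ 0 := by exact_mod_cast hτ.ne'
  have hB0 : 0 ≤ B := (norm_nonneg _).trans (hB 0 (left_mem_Icc.mpr zero_le_one))
  have h1 : (1 : ℝ) ∈ unitTime := right_mem_Icc.mpr zero_le_one
  have h0 : (0 : ℝ) ∈ unitTime := left_mem_Icc.mpr zero_le_one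
  have key := h.norm_rotated_sub_le hU n (ε := r ^ 2 * B / τ)
    (χ := fun s => ψ n s + ((τ : ℂ)⁻¹ * r) • firstCorr k e ψ n s)
    (χ' := fun s => r • frameVel k e ψ n s + ((τ : ℂ)⁻¹ * r) • (r • β' s))
    (fun s hs => (h.hasDeriv_frame hs n).add ((hβ s hs).fun_const_smul _))
    (fun s hs => by
      have hres : r • frameVel k e ψ n s + ((τ : ℂ)⁻¹ * r) • (r • β' s)
          + (Complex.I * (τ : ℂ)) • (K s (ψ n s + ((τ : ℂ)⁻¹ * r) • firstCorr k e ψ n s)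
            - (e n s : ℂ) • (ψ n s + ((τ : ℂ)⁻¹ * r) • firstCorr k e ψ n s))
          = ((τ : ℂ)⁻¹ * r * r) • β' s := by
        rw [map_add, map_smul, h.frame.eigen s hs n, h.op_firstCorr hs n, real_smul_ket,
          real_smul_ket]
        match_scalars <;> field_simp <;> ring_nf
        simp
      rw [hres, norm_smul]
      have : ‖(τ : ℂ)⁻¹ * r * r‖ = r ^ 2 / τ := by
        simp [abs_of_pos hτ, abs_of_nonneg hr]
        field_simp
      rw [this]
      calc r ^ 2 / τ * ‖β' s‖ ≤ r ^ 2 / τ * B := by gcongr; exact hB' s hs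
        _ = r ^ 2 * B / τ := by ring)
  have hn : ‖(τ : ℂ)⁻¹ * r‖ = r / τ := by
    simp [abs_of_pos hτ, abs_of_nonneg hr]
    field_simp
  have e1 : ‖U 1 (((τ : ℂ)⁻¹ * r) • firstCorr k e ψ n 0)‖ ≤ r / τ * B := by
    rw [hU.norm_apply h.selfAdjoint h1, norm_smul, hn]
    gcongr
    exact hB 0 h0
  have e2 : ‖phaseFactor τ (e n) 1 • ((τ : ℂ)⁻¹ * r) • firstCorr k e ψ n 1‖ ≤ r / τ * B := by
    rw [norm_smul, norm_phaseFactor, one_mul, norm_smul, hn]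
    gcongr
    exact hB 1 h1
  have hsplit : U 1 (ψ n 0) - phaseFactor τ (e n) 1 • ψ n 1 =
      phaseFactor τ (e n) 1 • ((τ : ℂ)⁻¹ * r) • firstCorr k e ψ n 1
      - U 1 (((τ : ℂ)⁻¹ * r) • firstCorr k e ψ n 0)
      - (phaseFactor τ (e n) 1 • (ψ n 1 + ((τ : ℂ)⁻¹ * r) • firstCorr k e ψ n 1)
        - U 1 (ψ n 0 + ((τ : ℂ)⁻¹ * r) • firstCorr k e ψ n 0)) := by
    rw [map_add, smul_add]
    abel
  rw [hsplit]
  calc _ ≤ r / τ * B + r / τ * B + r ^ 2 * B / τ :=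
        (norm_sub_le _ _).trans (add_le_add ((norm_sub_le _ _).trans (add_le_add e2 e1)) key)
    _ ≤ 2 * B * (r + r ^ 2) / τ := by
        have : 0 ≤ r ^ 2 * B / τ := by positivity
        have e : 2 * B * (r + r ^ 2) / τ = r / τ * B + r / τ * B + 2 * (r ^ 2 * B / τ) := by ring
        rw [e]; linarith

end GappedFrame

end Adiabatic

namespace Adiabatic

/-! ### The expansion of order two and the boundary terms -/

variable {N : ℕ}

/-- The projection `1 - |g⟩⟨g|`, for a unit vector `g`. -/
noncomputable def complProj (g : Ket N) : Op N :=
  ContinuousLinearMap.id ℂ (Ket N) - (innerSL ℂ g).smulRight g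

lemma complProj_apply (g v : Ket N) : complProj g v = v - (inner ℂ g v : ℂ) • g := by
  simp [complProj]

lemma norm_complProj_apply_le {g : Ket N} (hg : ‖g‖ = 1) (v : Ket N) :
    ‖complProj g v‖ ≤ 2 * ‖v‖ := by
  rw [complProj_apply]
  refine (norm_sub_le _ _).trans ?_
  have := norm_inner_le_norm (𝕜 := ℂ) g v
  rw [norm_smul, hg, mul_one]
  rw [hg, one_mul] at this
  linarith

namespace GappedFrame

variable {K : ℝ → Op N} {r : ℝ} {k : ℝ → Op N} {e : Fin N → ℝ → ℝ} {ψ : Fin N → ℝ → Ket N}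
  (h : GappedFrame K r k e ψ)

include h

/-- The expansion of order two for a non-degenerate level. The component `c` of the first-order
correction along the level itself is chosen so that the second-order equation is solvable. -/
lemma exists_norm_order_two_le {τ B : ℝ} (hτ : 0 < τ) (hr : 0 ≤ r) {U : ℝ → Op N}
    (hU : IsEvolution τ K U) {n : Fin N} (hn : ∀ s ∈ unitTime, ∀ m, m ≠ n → e m s ≠ e n s)
    {β' α' : ℝ → Ket N} (hv : ContinuousOn (frameVel k e ψ n) unitTime)
    (hβ : ∀ s ∈ unitTime, HasDerivWithinAt (firstCorr k e ψ n) (r • β' s) unitTime s)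
    (hα : ∀ s ∈ unitTime, HasDerivWithinAt (secondCorr e ψ β' n) (r • α' s) unitTime s)
    (hB : ∀ s ∈ unitTime, ‖firstCorr k e ψ n s‖ ≤ B) (hB' : ∀ s ∈ unitTime, ‖β' s‖ ≤ B)
    (hA' : ∀ s ∈ unitTime, ‖α' s‖ ≤ B)
    (hc : ∀ s ∈ unitTime, r ^ 2 * (‖frameVel k e ψ n s‖ * ‖firstCorr k e ψ n s‖) ≤ B * r) :
    ∃ c : ℂ, ‖c‖ ≤ B * r ∧
      ‖phaseFactor τ (e n) 1 • (ψ n 1 + (τ : ℂ)⁻¹ • ((r : ℂ) • firstCorr k e ψ n 1 + c • ψ n 1)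
          + ((τ : ℂ)⁻¹ ^ 2) • ((r : ℂ) ^ 2 • secondCorr e ψ β' n 1
            + (c * r) • firstCorr k e ψ n 1))
        - U 1 (ψ n 0 + (τ : ℂ)⁻¹ • (r : ℂ) • firstCorr k e ψ n 0
          + ((τ : ℂ)⁻¹ ^ 2) • (r : ℂ) ^ 2 • secondCorr e ψ β' n 0)‖
      ≤ (B + 2 * B ^ 2) * (r ^ 2 + r ^ 3) / τ ^ 2 := by
  have hτ' : (τ : ℂ) ≠ 0 := by exact_mod_cast hτ.ne'
  have h1 : (1 : ℝ) ∈ unitTime := right_mem_Icc.mpr zero_le_one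
  have h0 : (0 : ℝ) ∈ unitTime := left_mem_Icc.mpr zero_le_one
  have hB0 : 0 ≤ B := (norm_nonneg _).trans (hB 0 h0)
  have hβc : ContinuousOn (firstCorr k e ψ n) unitTime := fun s hs =>
    (hβ s hs).continuousWithinAt
  let c' : ℝ → ℂ := fun s => (r : ℂ) ^ 2 * inner ℂ (frameVel k e ψ n s) (firstCorr k e ψ n s)
  let c : ℝ → ℂ := fun s => ∫ ξ in (0 : ℝ)..s, c' ξ
  have hc'c : ContinuousOn c' unitTime := continuousOn_const.mul (hv.inner hβc)
  have hcd : ∀ s ∈ unitTime, HasDerivWithinAt c (c' s) unitTime s := fun s hs =>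
    hasDerivWithinAt_primitive hc'c hs
  have hc0 : c 0 = 0 := by simp [c]
  have hc'B : ∀ s ∈ unitTime, ‖c' s‖ ≤ B * r := by
    intro s hs
    refine le_trans ?_ (hc s hs)
    simp only [c', norm_mul, norm_pow, Complex.norm_real, Real.norm_of_nonneg hr]
    gcongr
    exact norm_inner_le_norm _ _
  have hcB : ∀ s ∈ unitTime, ‖c s‖ ≤ B * r := by
    intro s hs
    have h2 := intervalIntegral.norm_integral_le_of_norm_le_const (a := 0) (b := s) (f := c')
      (C := B * r) fun x hx => by
        rw [uIoc_of_le hs.1] at hx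
        exact hc'B x ⟨hx.1.le, hx.2.trans hs.2⟩
    refine h2.trans ?_
    rw [sub_zero, abs_of_nonneg hs.1]
    exact mul_le_of_le_one_right (by positivity) hs.2
  -- differentiating `⟨n, b⟩ = 0` gives the component along `|n⟩` of the derivative of `b`
  have hperp : ∀ s ∈ unitTime, (r : ℂ) * inner ℂ (ψ n s) (β' s) =
      -((r : ℂ) * inner ℂ (frameVel k e ψ n s) (firstCorr k e ψ n s)) := by
    intro s hs
    have hd := (h.hasDeriv_frame hs n).inner ℂ (hβ s hs)
    have hz := (hasDerivWithinAt_const s unitTime (0 : ℂ)).congr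
      (fun u hu => h.inner_firstCorr_self hu n) (h.inner_firstCorr_self hs n)
    have := (uniqueDiffWithinAt_unitTime hs).eq_deriv _ hd hz
    rw [real_smul_ket, real_smul_ket, inner_smul_right, inner_smul_left,
      Complex.conj_ofReal] at this
    linear_combination this
  refine ⟨c 1, hcB 1 h1, ?_⟩
  have key := h.norm_rotated_sub_le hU n (ε := (B + 2 * B ^ 2) * (r ^ 2 + r ^ 3) / τ ^ 2)
    (χ := fun s => ψ n s + (τ : ℂ)⁻¹ • ((r : ℂ) • firstCorr k e ψ n s + c s • ψ n s)
      + ((τ : ℂ)⁻¹ ^ 2) • ((r : ℂ) ^ 2 • secondCorr e ψ β' n s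
        + (c s * r) • firstCorr k e ψ n s))
    (χ' := fun s => r • frameVel k e ψ n s
      + (τ : ℂ)⁻¹ • ((r : ℂ) • r • β' s + (c s • r • frameVel k e ψ n s + c' s • ψ n s))
      + ((τ : ℂ)⁻¹ ^ 2) • ((r : ℂ) ^ 2 • r • α' s
        + ((c s * r) • r • β' s + (c' s * r) • firstCorr k e ψ n s)))
    (fun s hs => ((h.hasDeriv_frame hs n).add
      ((((hβ s hs).fun_const_smul _).add ((hcd s hs).smul (h.hasDeriv_frame hs n))).fun_const_smul
        _)).add ((((hα s hs).fun_const_smul _).add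
          (((hcd s hs).mul_const _).smul (hβ s hs))).fun_const_smul _))
    (fun s hs => by
      have hres : r • frameVel k e ψ n s
          + (τ : ℂ)⁻¹ • ((r : ℂ) • r • β' s + (c s • r • frameVel k e ψ n s + c' s • ψ n s))
          + ((τ : ℂ)⁻¹ ^ 2) • ((r : ℂ) ^ 2 • r • α' s
            + ((c s * r) • r • β' s + (c' s * r) • firstCorr k e ψ n s))
          + (Complex.I * (τ : ℂ)) •
            (K s (ψ n s + (τ : ℂ)⁻¹ • ((r : ℂ) • firstCorr k e ψ n s + c s • ψ n s)
              + ((τ : ℂ)⁻¹ ^ 2) • ((r : ℂ) ^ 2 • secondCorr e ψ β' n s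
                + (c s * r) • firstCorr k e ψ n s))
            - (e n s : ℂ) • (ψ n s + (τ : ℂ)⁻¹ • ((r : ℂ) • firstCorr k e ψ n s + c s • ψ n s)
              + ((τ : ℂ)⁻¹ ^ 2) • ((r : ℂ) ^ 2 • secondCorr e ψ β' n s
                + (c s * r) • firstCorr k e ψ n s)))
          = ((τ : ℂ)⁻¹ ^ 2) • ((r : ℂ) ^ 3 • α' s
            + ((c s * r ^ 2) • β' s + (c' s * r) • firstCorr k e ψ n s)) := by
        have hc's : c' s = -((r : ℂ) ^ 2 * inner ℂ (ψ n s) (β' s)) := by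
          simp only [c']
          linear_combination (r : ℂ) * hperp s hs
        simp only [map_add, map_smul, h.frame.eigen s hs n, h.op_firstCorr hs n,
          h.op_secondCorr hs (hn s hs) β', real_smul_ket, hc's]
        match_scalars <;> field_simp <;> ring_nf <;> simp
      rw [hres, norm_smul, norm_pow, norm_inv, Complex.norm_real, Real.norm_of_nonneg hτ.le]
      have e1 : ‖(r : ℂ) ^ 3 • α' s‖ ≤ r ^ 3 * B := by
        rw [norm_smul, norm_pow, Complex.norm_real, Real.norm_of_nonneg hr]
        gcongr
        exact hA' s hs
      have e2 : ‖(c s * r ^ 2) • β' s‖ ≤ B * r * r ^ 2 * B := by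
        rw [norm_smul, norm_mul, norm_pow, Complex.norm_real, Real.norm_of_nonneg hr]
        gcongr
        exacts [hcB s hs, hB' s hs]
      have e3 : ‖(c' s * r) • firstCorr k e ψ n s‖ ≤ B * r * r * B := by
        rw [norm_smul, norm_mul, Complex.norm_real, Real.norm_of_nonneg hr]
        gcongr
        exacts [hc'B s hs, hB s hs]
      have e4 : ‖(r : ℂ) ^ 3 • α' s + ((c s * r ^ 2) • β' s + (c' s * r) • firstCorr k e ψ n s)‖
          ≤ (B + 2 * B ^ 2) * (r ^ 2 + r ^ 3) := by
        refine (norm_add_le _ _).trans ((add_le_add e1 ((norm_add_le _ _).trans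
          (add_le_add e2 e3))).trans ?_)
        have : 0 ≤ B * r ^ 2 := by positivity
        have : 0 ≤ B ^ 2 * r ^ 2 := by positivity
        have : 0 ≤ B ^ 2 * r ^ 3 := by positivity
        linarith
      calc _ ≤ τ⁻¹ ^ 2 * ((B + 2 * B ^ 2) * (r ^ 2 + r ^ 3)) := by gcongr
        _ = _ := by field_simp)
  simp only [hc0, zero_smul, zero_mul, add_zero] at key
  exact key

lemma inner_dotKet_frame {s : ℝ} (hs : s ∈ unitTime) (n m : Fin N) :
    (inner ℂ (dotKet (ψ m) s) (ψ n s) : ℂ) = r * (invGap e n m s * coupling k ψ n m s) := by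
  have hd := (h.hasDeriv_dotKet hs m).inner ℂ (h.hasDeriv_dotKet hs n)
  have hz := (hasDerivWithinAt_const s unitTime (if m = n then (1 : ℂ) else 0)).congr
    (fun u hu => h.inner_frame hu m n) (h.inner_frame hs m n)
  have h2 := (uniqueDiffWithinAt_unitTime hs).eq_deriv _ hd hz
  rw [h.inner_frame_dotKet hs, Complex.real_smul] at h2
  linear_combination h2

lemma boundarySum_eq (τ : ℝ) {s : ℝ} (hs : s ∈ unitTime) (n : Fin N) :
    boundarySum τ e ψ n s = ((τ : ℂ)⁻¹ * r) • ∑ m, (phaseFactor τ (e m) 1 *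
      phaseFactor τ (gap e n m) s * corrCoeff k e ψ n m s) • ψ m 1 := by
  rw [boundarySum, ← Finset.sum_erase (a := n) Finset.univ
    (by simp [corrCoeff, invGap]), Finset.smul_sum]
  refine Finset.sum_congr rfl fun m _ => ?_
  rw [smul_smul, h.inner_dotKet_frame hs]
  congr 1
  have hw : (-(Complex.I * ((gap e n m s : ℝ) : ℂ) * (τ : ℂ)))⁻¹ =
      -Complex.I * invGap e n m s * (τ : ℂ)⁻¹ := by
    have : -(Complex.I * ((gap e n m s : ℝ) : ℂ) * (τ : ℂ)) =
        Complex.I * ((e m s : ℂ) - e n s) * τ := by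
      rw [gap]; push_cast; ring
    rw [this, mul_inv, mul_inv, Complex.inv_I, invGap]
  rw [div_eq_mul_inv, hw, corrCoeff, phase]
  simp only [phaseFactor]
  ring

lemma boundarySum_one (τ : ℝ) (n : Fin N) : boundarySum τ e ψ n 1 =
    ((τ : ℂ)⁻¹ * r) • phaseFactor τ (e n) 1 • firstCorr k e ψ n 1 := by
  have h1 : (1 : ℝ) ∈ unitTime := right_mem_Icc.mpr zero_le_one
  have hint : ∀ m, IntervalIntegrable (e m) MeasureTheory.volume 0 1 := fun m =>
    ContinuousOn.intervalIntegrable (by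
      rw [uIcc_of_le zero_le_one]; exact h.continuousOn_energy m)
  rw [h.boundarySum_eq τ h1, firstCorr, Finset.smul_sum (r := phaseFactor τ (e n) 1)]
  congr 1
  refine Finset.sum_congr rfl fun m _ => ?_
  rw [smul_smul]
  congr 2
  simp only [phaseFactor, gap]
  rw [intervalIntegral.integral_sub (hint n) (hint m), ← Complex.exp_add]
  congr 1
  push_cast
  ring

lemma boundarySum_zero (τ : ℝ) (n : Fin N) : boundarySum τ e ψ n 0 =
    ((τ : ℂ)⁻¹ * r) • ∑ m, (phaseFactor τ (e m) 1 * corrCoeff k e ψ n m 0) • ψ m 1 := by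
  rw [h.boundarySum_eq τ (left_mem_Icc.mpr zero_le_one)]
  simp [phaseFactor]

/-- The first-order adiabatic theorem with an explicit error, for a single Hamiltonian. -/
lemma norm_adiabaticError_sub_le {τ B : ℝ} (hτ : 0 < τ) (hr : 0 ≤ r) {U : ℝ → Op N}
    (hU : IsEvolution τ K U) {n : Fin N} (hn : ∀ s ∈ unitTime, ∀ m, m ≠ n → e m s ≠ e n s)
    {β' : Fin N → ℝ → Ket N} {α' : ℝ → Ket N}
    (hv : ContinuousOn (frameVel k e ψ n) unitTime)
    (hβ : ∀ m, ∀ s ∈ unitTime, HasDerivWithinAt (firstCorr k e ψ m) (r • β' m s) unitTime s)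
    (hα : ∀ s ∈ unitTime, HasDerivWithinAt (secondCorr e ψ (β' n) n) (r • α' s) unitTime s)
    (hk : ∀ s ∈ unitTime, ‖k s‖ ≤ B)
    (hB : ∀ m, ∀ s ∈ unitTime, ‖firstCorr k e ψ m s‖ ≤ B)
    (hB' : ∀ m, ∀ s ∈ unitTime, ‖β' m s‖ ≤ B)
    (hA : ∀ s ∈ unitTime, ‖secondCorr e ψ (β' n) n s‖ ≤ B) (hA' : ∀ s ∈ unitTime, ‖α' s‖ ≤ B)
    (hc : ∀ s ∈ unitTime, r ^ 2 * (‖frameVel k e ψ n s‖ * ‖firstCorr k e ψ n s‖) ≤ B * r) :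
    ‖adiabaticError U ψ n - boundaryTerm τ e ψ n‖ ≤
      2 * (3 * B + (3 + 2 * N) * B ^ 2) * ((r ^ 2 + r ^ 3) / τ ^ 2) := by
  have h1 : (1 : ℝ) ∈ unitTime := right_mem_Icc.mpr zero_le_one
  have h0 : (0 : ℝ) ∈ unitTime := left_mem_Icc.mpr zero_le_one
  have hB0 : 0 ≤ B := (norm_nonneg _).trans (hB n 0 h0)
  obtain ⟨c, hcB, hD⟩ := h.exists_norm_order_two_le hτ hr hU hn hv (hβ n) hα (hB n) (hB' n) hA' hc
  set p : ℂ := phaseFactor τ (e n) 1 with hp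
  have hp1 : ‖p‖ = 1 := norm_phaseFactor _ _ _
  set D := p • (ψ n 1 + (τ : ℂ)⁻¹ • ((r : ℂ) • firstCorr k e ψ n 1 + c • ψ n 1)
          + ((τ : ℂ)⁻¹ ^ 2) • ((r : ℂ) ^ 2 • secondCorr e ψ (β' n) n 1
            + (c * r) • firstCorr k e ψ n 1))
        - U 1 (ψ n 0 + (τ : ℂ)⁻¹ • (r : ℂ) • firstCorr k e ψ n 0
          + ((τ : ℂ)⁻¹ ^ 2) • (r : ℂ) ^ 2 • secondCorr e ψ (β' n) n 0) with hDdef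
  let δ : Fin N → Ket N := fun m => U 1 (ψ m 0) - phaseFactor τ (e m) 1 • ψ m 1
  let κ : Fin N → ℂ := fun m => corrCoeff k e ψ n m 0
  set S := ∑ m, κ m • δ m with hS
  set L := ∑ m, (phaseFactor τ (e m) 1 * κ m) • ψ m 1 with hL
  set Q := complProj (ψ n 1) with hQ
  have hU1 : U 1 (firstCorr k e ψ n 0) = S + L := by
    rw [firstCorr, map_sum, hS, hL, ← Finset.sum_add_distrib]
    refine Finset.sum_congr rfl fun m _ => ?_
    rw [map_smul]
    simp only [κ, δ]
    module
  have hQψ : Q (ψ n 1) = 0 := by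
    rw [hQ, complProj_apply, h.inner_frame h1, if_pos rfl, one_smul, sub_self]
  have hQβ : Q (firstCorr k e ψ n 1) = firstCorr k e ψ n 1 := by
    rw [hQ, complProj_apply, h.inner_firstCorr_self h1, zero_smul, sub_zero]
  have hQL : Q L = L := by
    rw [hQ, complProj_apply, hL, h.inner_sum_frame h1]
    simp [κ, corrCoeff, invGap]
  -- the terms of second order, left over once the boundary terms are split off from `U 1 (ψ n 0)`
  set X := p • ((τ : ℂ)⁻¹ ^ 2) • ((r : ℂ) ^ 2 • secondCorr e ψ (β' n) n 1
      + (c * r) • firstCorr k e ψ n 1) - D - ((τ : ℂ)⁻¹ * r) • S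
      - ((τ : ℂ)⁻¹ ^ 2) • (r : ℂ) ^ 2 • U 1 (secondCorr e ψ (β' n) n 0) with hX
  have hsplit : adiabaticError U ψ n - boundaryTerm τ e ψ n = Q X := by
    have hQU : adiabaticError U ψ n = Q (U 1 (ψ n 0)) := by
      rw [hQ, complProj_apply, adiabaticError]
    have hUg : U 1 (ψ n 0) = X + p • (ψ n 1 + (τ : ℂ)⁻¹ • ((r : ℂ) • firstCorr k e ψ n 1
        + c • ψ n 1)) - ((τ : ℂ)⁻¹ * r) • L := by
      rw [hX, hDdef]
      simp only [map_add, map_smul, hU1]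
      module
    rw [hQU, boundaryTerm, h.boundarySum_one, h.boundarySum_zero, hUg]
    simp only [map_add, map_sub, map_smul, hQψ, hQβ, hQL]
    rw [← hp]
    change _ - (_ - ((τ : ℂ)⁻¹ * r) • L) = _
    module
  have hτn : ‖(τ : ℂ)⁻¹‖ = τ⁻¹ := by
    rw [norm_inv, Complex.norm_real, Real.norm_of_nonneg hτ.le]
  have hrn : ‖(r : ℂ)‖ = r := by rw [Complex.norm_real, Real.norm_of_nonneg hr]
  have b1 : ‖p • ((τ : ℂ)⁻¹ ^ 2) • ((r : ℂ) ^ 2 • secondCorr e ψ (β' n) n 1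
      + (c * r) • firstCorr k e ψ n 1)‖ ≤ τ⁻¹ ^ 2 * (r ^ 2 * B + B * r * r * B) := by
    rw [norm_smul, hp1, one_mul, norm_smul, norm_pow, hτn]
    gcongr
    refine (norm_add_le _ _).trans ?_
    rw [norm_smul, norm_pow, hrn, norm_smul, norm_mul, hrn]
    gcongr
    exacts [hA 1 h1, hB n 1 h1]
  have b2 : ‖((τ : ℂ)⁻¹ * r) • S‖ ≤ τ⁻¹ * r * (N * (B * (2 * B * (r + r ^ 2) / τ))) := by
    rw [norm_smul, norm_mul, hτn, hrn]
    gcongr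
    refine (norm_sum_le _ _).trans ?_
    calc ∑ m, ‖κ m • δ m‖ ≤ ∑ _m : Fin N, B * (2 * B * (r + r ^ 2) / τ) := by
          refine Finset.sum_le_sum fun m _ => ?_
          rw [norm_smul]
          gcongr
          · exact (h.norm_corrCoeff_le h0 n m).trans (hk 0 h0)
          · exact h.norm_order_zero_le hτ hr hU m (hβ m) (hB m) (hB' m)
      _ = _ := by simp
  have b3 : ‖((τ : ℂ)⁻¹ ^ 2) • (r : ℂ) ^ 2 • U 1 (secondCorr e ψ (β' n) n 0)‖ ≤
      τ⁻¹ ^ 2 * (r ^ 2 * B) := by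
    rw [norm_smul, norm_pow, hτn, norm_smul, norm_pow, hrn, hU.norm_apply h.selfAdjoint h1]
    gcongr
    exact hA 0 h0
  have hXn : ‖X‖ ≤ (3 * B + (3 + 2 * N) * B ^ 2) * ((r ^ 2 + r ^ 3) / τ ^ 2) := by
    calc ‖X‖ ≤ τ⁻¹ ^ 2 * (r ^ 2 * B + B * r * r * B)
          + (B + 2 * B ^ 2) * (r ^ 2 + r ^ 3) / τ ^ 2
          + τ⁻¹ * r * (N * (B * (2 * B * (r + r ^ 2) / τ))) + τ⁻¹ ^ 2 * (r ^ 2 * B) :=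
          (norm_sub_le _ _).trans (add_le_add ((norm_sub_le _ _).trans (add_le_add
            ((norm_sub_le _ _).trans (add_le_add b1 hD)) b2)) b3)
      _ = ((2 * B + B ^ 2) * r ^ 2 + (B + (2 + 2 * N) * B ^ 2) * (r ^ 2 + r ^ 3)) / τ ^ 2 := by
          field_simp
          ring
      _ ≤ (3 * B + (3 + 2 * N) * B ^ 2) * (r ^ 2 + r ^ 3) / τ ^ 2 := by
          gcongr
          have : 0 ≤ (2 * B + B ^ 2) * r ^ 3 := by positivity
          linarith
      _ = _ := by ring
  rw [hsplit]
  refine (norm_complProj_apply_le (h.norm_frame h1 n) X).trans ?_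
  rw [mul_assoc]
  gcongr

end GappedFrame

/-- The first-order adiabatic theorem with an error that is uniform over a family of Hamiltonians
with gap at least `1`, whose derivatives are controlled by `ρ`. -/
theorem exists_norm_adiabaticError_sub_le {ι : Type*} {ρ τ : ι → ℝ} {K k U : ι → ℝ → Op N}
    {e : ι → Fin N → ℝ → ℝ} {ψ : ι → Fin N → ℝ → Ket N}
    (h : ∀ i, GappedFrame (K i) (ρ i) (k i) (e i) (ψ i)) (hk : Tame ρ 2 k)
    (hρ : ∀ i, 0 ≤ ρ i) (hτ : ∀ i, 0 < τ i) (hkρ : ∀ i, ∀ s ∈ unitTime, (ρ i * ‖k i s‖) ^ 2 ≤ ρ i)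
    (hU : ∀ i, IsEvolution (τ i) (K i) (U i)) (n : Fin N)
    (hn : ∀ i, ∀ s ∈ unitTime, ∀ m, m ≠ n → e i m s ≠ e i n s) :
    ∃ C : ℝ, ∀ i, ‖adiabaticError (U i) (ψ i) n - boundaryTerm (τ i) (e i) (ψ i) n‖ ≤
      C * ((ρ i ^ 2 + ρ i ^ 3) / τ i ^ 2) := by
  obtain ⟨hψ, hw⟩ := tame_frame_invGap h hk
  have hψ2 := fun n => (hψ n).of_succ
  have hw2 := fun n m => (hw n m).of_succ
  have hv := tame_frameVel hk hψ2 hw2 n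
  have hβ := tame_firstCorr hk hψ2 hw2
  choose β' hβ' hβ1 using fun m => (hβ m).2
  have hα := tame_secondCorr (hβ1 n) (fun m => (hψ2 m).of_succ) (fun l m => (hw2 l m).of_succ) n
  obtain ⟨α', hα', hα0⟩ := hα.2
  obtain ⟨B1, h10, hB1⟩ := hk.bound
  choose B2 h20 hB2 using fun m => (hβ m).bound
  choose B3 h30 hB3 using fun m => (hβ1 m).bound
  obtain ⟨B4, h40, hB4⟩ := hα.bound
  obtain ⟨B5, h50, hB5⟩ := hα0.bound
  let B := B1 + ∑ m, B2 m + ∑ m, B3 m + B4 + B5 + (N : ℝ) ^ 2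
  have hs2 : 0 ≤ ∑ m, B2 m := Finset.sum_nonneg fun m _ => h20 m
  have hs3 : 0 ≤ ∑ m, B3 m := Finset.sum_nonneg fun m _ => h30 m
  have hN : (0 : ℝ) ≤ (N : ℝ) ^ 2 := by positivity
  have le2 : ∀ m, B2 m ≤ ∑ m, B2 m := fun m =>
    Finset.single_le_sum (fun m _ => h20 m) (Finset.mem_univ m)
  have le3 : ∀ m, B3 m ≤ ∑ m, B3 m := fun m =>
    Finset.single_le_sum (fun m _ => h30 m) (Finset.mem_univ m)
  refine ⟨2 * (3 * B + (3 + 2 * N) * B ^ 2), fun i => ?_⟩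
  refine (h i).norm_adiabaticError_sub_le (hτ i) (hρ i) (hU i) (hn i) (hv.continuousOn i)
    (fun m => hβ' m i) (hα' i) (fun s hs => (hB1 i s hs).trans ?_)
    (fun m s hs => (hB2 m i s hs).trans ((le2 m).trans ?_))
    (fun m s hs => (hB3 m i s hs).trans ((le3 m).trans ?_))
    (fun s hs => (hB4 i s hs).trans ?_) (fun s hs => (hB5 i s hs).trans ?_) (fun s hs => ?_)
  iterate 5 simp only [B]; linarith
  calc ρ i ^ 2 * (‖frameVel (k i) (e i) (ψ i) n s‖ * ‖firstCorr (k i) (e i) (ψ i) n s‖)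
      ≤ ρ i ^ 2 * ((N * ‖k i s‖) * (N * ‖k i s‖)) := by
        gcongr
        · exact (h i).norm_frameVel_le hs n
        · exact (h i).norm_firstCorr_le hs n
    _ = (N : ℝ) ^ 2 * (ρ i * ‖k i s‖) ^ 2 := by ring
    _ ≤ B * ρ i := by
        have := hρ i
        have hNB : (N : ℝ) ^ 2 ≤ B := by simp only [B]; linarith
        gcongr
        exact hkρ i s hs

end Adiabatic

namespace Adiabatic

/-! ### Rescaling to unit gap -/

variable {N : ℕ}

lemma real_smul_op (r : ℝ) (A : Op N) : r • A = (r : ℂ) • A := by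
  ext1 v
  exact real_smul_ket r (A v)

lemma maxNorm_nonneg (k : ℕ) (H : ℝ → Op N) : 0 ≤ maxNorm k H :=
  Real.sSup_nonneg (by rintro _ ⟨s, _, rfl⟩; exact norm_nonneg _)

lemma IsHamiltonian.hasDerivWithinAt_derivH {H : ℝ → Op N} (hH : IsHamiltonian H) {j : ℕ}
    (hj : j < 3) {s : ℝ} (hs : s ∈ unitTime) :
    HasDerivWithinAt (derivH j H) (derivH (j + 1) H s) unitTime s := by
  have h := (hH.differentiable j hj s hs).hasDerivWithinAt
  rwa [derivH, iteratedDerivWithin_succ]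

lemma IsHamiltonian.norm_derivH_le {H : ℝ → Op N} (hH : IsHamiltonian H) {j : ℕ}
    (hj : j ≤ 3) {s : ℝ} (hs : s ∈ unitTime) : ‖derivH j H s‖ ≤ maxNorm j H := by
  refine le_csSup ?_ ⟨s, hs, rfl⟩
  rcases hj.lt_or_eq with hj | rfl
  · exact (isCompact_Icc.image_of_continuousOn
      (hH.differentiable j hj).continuousOn.norm).bddAbove
  · exact hH.bounded

lemma IsEigenframe.minGap_le {H : ℝ → Op N} {E : Fin N → ℝ → ℝ} {ψ : Fin N → ℝ → Ket N}
    (hψ : IsEigenframe H E ψ) {s : ℝ} (hs : s ∈ unitTime) {n m : Fin N} (hnm : E n s ≠ E m s) :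
    minGap H ≤ |E n s - E m s| := by
  have hev : ∀ l, Module.End.HasEigenvalue (H s : Ket N →ₗ[ℂ] Ket N) (E l s : ℂ) := fun l =>
    Module.End.hasEigenvalue_of_hasEigenvector (x := ψ l s)
      ⟨Module.End.mem_eigenspace_iff.mpr (hψ.eigen s hs l), (hψ.orthonormal s hs).ne_zero l⟩
  refine csInf_le ⟨0, ?_⟩ ⟨s, hs, E n s, E m s, hev n, hev m, hnm, rfl⟩
  rintro _ ⟨_, _, _, _, _, _, _, rfl⟩
  exact abs_nonneg _

/-- Division of the energy by the minimum gap yields a Hamiltonian with gap at least `1`. -/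
lemma IsEigenframe.gappedFrame {H : ℝ → Op N} {E : Fin N → ℝ → ℝ} {ψ : Fin N → ℝ → Ket N}
    (hψ : IsEigenframe H E ψ) (hH : IsHamiltonian H) {r : ℝ} (hγ : 0 < minGap H)
    (hr : maxNorm 1 H / minGap H ≤ r) :
    GappedFrame (fun s => (minGap H)⁻¹ • H s) r (fun s => r⁻¹ • (minGap H)⁻¹ • derivH 1 H s)
      (fun n s => (minGap H)⁻¹ * E n s) ψ where
  selfAdjoint s hs := by
    rw [real_smul_op]
    exact IsSelfAdjoint.smul (Complex.conj_ofReal _) (hH.selfAdjoint s hs)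
  hasDeriv s hs := by
    have h := (hH.hasDerivWithinAt_derivH (j := 0) (by norm_num) hs).fun_const_smul (minGap H)⁻¹
    simp only [derivH, iteratedDerivWithin_zero, zero_add] at h
    refine h.congr_deriv ?_
    change _ • derivH 1 H s = _
    rcases eq_or_ne r 0 with rfl | hr0
    · -- the derivative vanishes, in agreement with `0⁻¹ = 0`
      have h0 : ‖derivH 1 H s‖ ≤ 0 :=
        (hH.norm_derivH_le (by norm_num) hs).trans (by rwa [div_le_iff₀ hγ, zero_mul] at hr)
      have h0' : derivH 1 H s = 0 := norm_le_zero_iff.mp h0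
      rw [h0', smul_zero]
      ext1 v
      simp
    · rw [smul_inv_smul₀ hr0]
  frame :=
    { orthonormal := hψ.orthonormal
      eigen := fun s hs n => by
        rw [smul_apply, hψ.eigen s hs n, real_smul_ket, smul_smul]
        push_cast
        rfl
      differentiable := hψ.differentiable
      transport := fun s hs n m hnm =>
        hψ.transport s hs n m (mul_left_cancel₀ (inv_ne_zero hγ.ne') hnm) }
  one_le_gap s hs n m hnm := by
    have h := hψ.minGap_le hs (n := n) (m := m) fun hh => hnm (by rw [hh])
    rw [← mul_sub, abs_mul, abs_inv, abs_of_pos hγ, inv_mul_eq_div, le_div_iff₀ hγ, one_mul]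
    exact h

lemma IsEvolution.rescale {T g : ℝ} {H U : ℝ → Op N} (hU : IsEvolution T H U) (hg : g ≠ 0) :
    IsEvolution (g * T) (fun s => g⁻¹ • H s) U where
  initial := hU.initial
  schrodinger s hs := by
    refine (hU.schrodinger s hs).congr_deriv ?_
    have hg' : (g : ℂ) ≠ 0 := by exact_mod_cast hg
    rw [real_smul_op, smul_mul_assoc, smul_smul]
    congr 1
    push_cast
    field_simp

lemma boundaryTerm_rescale {T g : ℝ} (hg : g ≠ 0) (E : Fin N → ℝ → ℝ) (ψ : Fin N → ℝ → Ket N)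
    (G : Fin N) :
    boundaryTerm (g * T) (fun n s => g⁻¹ * E n s) ψ G = boundaryTerm T E ψ G := by
  have hg' : (g : ℂ) ≠ 0 := by exact_mod_cast hg
  have hsum : ∀ s, boundarySum (g * T) (fun n s => g⁻¹ * E n s) ψ G s = boundarySum T E ψ G s := by
    intro s
    refine Finset.sum_congr rfl fun m _ => ?_
    have hgap : ∀ u, gap (fun n s => g⁻¹ * E n s) G m u = g⁻¹ * gap E G m u := fun u =>
      (mul_sub _ _ _).symm
    have hx : ∀ x : ℝ, g⁻¹ * x * (g * T) = x * T := fun x => by field_simp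
    have hy : Complex.I * ((g⁻¹ * gap E G m s : ℝ) : ℂ) * ((g * T : ℝ) : ℂ) =
        Complex.I * (gap E G m s : ℂ) * (T : ℂ) := by
      rw [mul_assoc, ← Complex.ofReal_mul, hx, Complex.ofReal_mul, mul_assoc]
    simp only [phase, hgap, intervalIntegral.integral_const_mul, hx, hy]
  rw [boundaryTerm, boundaryTerm, hsum, hsum]

/-- The derivative of the rescaled Hamiltonians is tame if the rates `ρ` dominate the derivatives
relative to the gap. -/
lemma tame_rescaled {ι : Type*} {ρ : ι → ℝ} {H : ι → ℝ → Op N} (hH : ∀ i, IsHamiltonian (H i))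
    (hγ : ∀ i, 0 < minGap (H i)) (hρ : ∀ i, 0 ≤ ρ i)
    (hd : ∀ i, ∀ j ≤ 3, maxNorm j (H i) / minGap (H i) ≤ ρ i ^ j ∨ j = 0) :
    Tame ρ 2 (fun i s => (ρ i)⁻¹ • (minGap (H i))⁻¹ • derivH 1 (H i) s) := by
  have hbound : ∀ j ≤ 3, j ≠ 0 →
      Tame ρ 0 (fun i s => ((ρ i)⁻¹ ^ j) • (minGap (H i))⁻¹ • derivH j (H i) s) := by
    intro j hj hj0
    refine ⟨1, fun i s hs => ?_⟩
    have h1 := (hH i).norm_derivH_le hj hs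
    have h2 := (hd i j hj).resolve_right hj0
    have hg := hγ i
    have hr := hρ i
    rw [norm_smul, norm_smul, norm_pow, norm_inv, norm_inv, Real.norm_of_nonneg hr,
      Real.norm_of_nonneg hg.le]
    calc (ρ i)⁻¹ ^ j * ((minGap (H i))⁻¹ * ‖derivH j (H i) s‖)
        ≤ (ρ i)⁻¹ ^ j * ((minGap (H i))⁻¹ * maxNorm j (H i)) := by gcongr
      _ = (ρ i)⁻¹ ^ j * (maxNorm j (H i) / minGap (H i)) := by rw [inv_mul_eq_div]
      _ ≤ (ρ i)⁻¹ ^ j * ρ i ^ j := by gcongr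
      _ = ((ρ i)⁻¹ * ρ i) ^ j := (mul_pow _ _ _).symm
      _ ≤ 1 := pow_le_one₀ (by positivity) (inv_mul_le_one)
  have hderiv : ∀ j < 3, j ≠ 0 → ∀ i, ∀ s ∈ unitTime,
      HasDerivWithinAt (fun s => ((ρ i)⁻¹ ^ j) • (minGap (H i))⁻¹ • derivH j (H i) s)
        (ρ i • ((ρ i)⁻¹ ^ (j + 1)) • (minGap (H i))⁻¹ • derivH (j + 1) (H i) s) unitTime s := by
    intro j hj hj0 i s hs
    refine ((((hH i).hasDerivWithinAt_derivH hj hs).fun_const_smul _).fun_const_smul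
      _).congr_deriv ?_
    rw [smul_smul (ρ i)]
    congr 1
    rcases eq_or_ne (ρ i) 0 with h0 | h0
    · simp [h0, hj0]
    · rw [pow_succ', mul_inv_cancel_left₀ h0]
  have h := (hbound 1 (by norm_num) (by norm_num)).succ (hderiv 1 (by norm_num) (by norm_num))
    ((hbound 2 (by norm_num) (by norm_num)).succ (hderiv 2 (by norm_num) (by norm_num))
      (hbound 3 (by norm_num) (by norm_num)))
  simpa only [pow_one] using h

/-- A rate `ρ` which dominates the relative sizes `x₁, x₂, x₃` of the derivatives of the
Hamiltonian, and is itself controlled by `D = x₃ + x₂³ + x₁⁶`. -/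
lemma exists_rate {c x₁ x₂ x₃ : ℝ} (hc : 0 < c) (hc1 : c ≤ 1) (h₂ : 0 ≤ x₂)
    (h₃ : 0 ≤ x₃) (hD : x₃ + x₂ ^ 3 + x₁ ^ 6 = 0 ∨ c ≤ x₃ + x₂ ^ 3 + x₁ ^ 6) :
    ∃ ρ : ℝ, 0 ≤ ρ ∧ x₁ ≤ ρ ∧ x₁ ^ 2 ≤ ρ ∧ x₂ ≤ ρ ^ 2 ∧ x₃ ≤ ρ ^ 3 ∧
      ρ ^ 2 + ρ ^ 3 ≤ 2 / c * (x₃ + x₂ ^ 3 + x₁ ^ 6) := by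
  have p2 : 0 ≤ x₂ ^ 3 := by positivity
  have p1 : 0 ≤ x₁ ^ 6 := by positivity
  set D := x₃ + x₂ ^ 3 + x₁ ^ 6 with hDdef
  rcases hD with h0 | hD
  · have e3 : x₃ = 0 := by linarith
    have e2 : x₂ = 0 := pow_eq_zero_iff (n := 3) (by norm_num) |>.mp (by linarith)
    have e1 : x₁ = 0 := pow_eq_zero_iff (n := 6) (by norm_num) |>.mp (by linarith)
    exact ⟨0, by simp [e1, e2, e3, h0]⟩
  · -- `D / c ≥ 1`, so its cube root is at least `1` and dominates `x₂` and `x₁ ^ 2`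
    have hM1 : 1 ≤ D / c := by rwa [one_le_div hc]
    have hDM : D ≤ D / c := le_div_self (by linarith) hc hc1
    set ρ := (D / c) ^ ((1 : ℝ) / 3) with hρ
    have hρ3 : ρ ^ 3 = D / c := by
      rw [hρ, ← Real.rpow_natCast, ← Real.rpow_mul (by linarith)]
      norm_num
    have hρ1 : 1 ≤ ρ := Real.one_le_rpow hM1 (by norm_num)
    have hρ0 : 0 ≤ ρ := by linarith
    have h23 : ρ ^ 2 ≤ ρ ^ 3 := pow_le_pow_right₀ hρ1 (by norm_num)
    have h12 : ρ ≤ ρ ^ 2 := le_self_pow₀ hρ1 (by norm_num)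
    have hx1 : x₁ ^ 2 ≤ ρ := by
      refine le_of_pow_le_pow_left₀ (n := 3) (by norm_num) hρ0 ?_
      rw [hρ3, ← pow_mul]
      linarith
    have hx2 : x₂ ≤ ρ := by
      refine le_of_pow_le_pow_left₀ (n := 3) (by norm_num) hρ0 ?_
      rw [hρ3]
      linarith
    refine ⟨ρ, hρ0, ?_, hx1, hx2.trans h12, by rw [hρ3]; linarith, ?_⟩
    · rcases le_total x₁ 1 with hle | hle
      · exact hle.trans hρ1
      · exact (le_self_pow₀ hle (by norm_num)).trans hx1
    · calc ρ ^ 2 + ρ ^ 3 ≤ 2 * ρ ^ 3 := by linarith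
        _ = 2 / c * D := by rw [hρ3]; ring

lemma minGap_mul_Delta1 {H : ℝ → Op N} (hγ : 0 < minGap H) :
    minGap H * Delta1 H = maxNorm 3 H / minGap H + (maxNorm 2 H / minGap H) ^ 3
      + (maxNorm 1 H / minGap H) ^ 6 := by
  rw [Delta1]
  field_simp

end Adiabatic

theorem theorem2 (N : ℕ) (H : ℝ → ℝ → Adiabatic.Op N) (U : ℝ → ℝ → Adiabatic.Op N)
    (E : ℝ → Fin N → ℝ → ℝ) (ψ : ℝ → Fin N → ℝ → Adiabatic.Ket N) (G : Fin N)
    (hH : ∀ T : ℝ, 0 < T → Adiabatic.IsHamiltonian (H T))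
    (hgap : ∀ T : ℝ, 0 < T → 0 < Adiabatic.minGap (H T))
    (hU : ∀ T : ℝ, 0 < T → Adiabatic.IsEvolution T (H T) (U T))
    (hψ : ∀ T : ℝ, 0 < T → Adiabatic.IsEigenframe (H T) (E T) (ψ T))
    (hG : ∀ T : ℝ, 0 < T → ∀ s ∈ Adiabatic.unitTime, ∀ ν : Fin N, ν ≠ G → E T ν s ≠ E T G s)
    (hlarge : ∃ c : ℝ, 0 < c ∧ ∀ᶠ T : ℝ in atTop,
      Adiabatic.Delta1 (H T) = 0 ∨ c ≤ Adiabatic.minGap (H T) * Adiabatic.Delta1 (H T))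
    (hsmall : (fun T : ℝ => Adiabatic.Delta1 (H T)) =o[atTop]
      (fun T : ℝ => Adiabatic.minGap (H T) * T ^ 2)) :
    (fun T : ℝ => Adiabatic.adiabaticError (U T) (ψ T) G
        - Adiabatic.boundaryTerm T (E T) (ψ T) G) =O[atTop]
      (fun T : ℝ => Adiabatic.Delta1 (H T) / (Adiabatic.minGap (H T) * T ^ 2)) := by
  open Adiabatic in
  obtain ⟨c₀, hc₀, hev⟩ := hlarge
  set c := min c₀ 1
  have hc : 0 < c := lt_min hc₀ one_pos
  -- the estimate is uniform over the parameters at which the lower bound on `Δ₁` holds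
  let good : Set ℝ := {T | 0 < T ∧ (Delta1 (H T) = 0 ∨ c₀ ≤ minGap (H T) * Delta1 (H T))}
  have hgood : ∀ᶠ T in atTop, T ∈ good := (eventually_gt_atTop 0).and hev
  have hrate : ∀ T : good, ∃ ρ : ℝ, 0 ≤ ρ ∧ maxNorm 1 (H T) / minGap (H T) ≤ ρ ∧
      (maxNorm 1 (H T) / minGap (H T)) ^ 2 ≤ ρ ∧ maxNorm 2 (H T) / minGap (H T) ≤ ρ ^ 2 ∧
      maxNorm 3 (H T) / minGap (H T) ≤ ρ ^ 3 ∧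
      ρ ^ 2 + ρ ^ 3 ≤ 2 / c * (minGap (H T) * Delta1 (H T)) := by
    rintro ⟨T, hT, hT'⟩
    have hγ := hgap T hT
    simp only [minGap_mul_Delta1 hγ]
    refine exists_rate hc (min_le_right _ _)
      (div_nonneg (maxNorm_nonneg _ _) hγ.le) (div_nonneg (maxNorm_nonneg _ _) hγ.le) ?_
    rw [← minGap_mul_Delta1 hγ]
    exact hT'.imp (fun h => by rw [h, mul_zero]) (fun h => (min_le_left _ _).trans h)
  choose ρ hρ0 h1 h1' h2 h3 hρD using hrate
  have hγ : ∀ T : good, 0 < minGap (H T) := fun T => hgap T T.2.1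
  have hd : ∀ T : good, ∀ j ≤ 3, maxNorm j (H T) / minGap (H T) ≤ ρ T ^ j ∨ j = 0 := by
    intro T j hj
    interval_cases j
    exacts [Or.inr rfl, Or.inl (by simpa using h1 T), Or.inl (h2 T), Or.inl (h3 T)]
  obtain ⟨C, hC⟩ := exists_norm_adiabaticError_sub_le (ι := good) (ρ := ρ)
    (τ := fun T => minGap (H T) * T) (U := fun T => U T) (ψ := fun T => ψ T)
    (fun T => (hψ T T.2.1).gappedFrame (hH T T.2.1) (hγ T) (h1 T))
    (tame_rescaled (H := fun T : good => H T) (fun T => hH T T.2.1) hγ hρ0 hd) hρ0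
    (fun T => mul_pos (hγ T) T.2.1)
    (fun T s hs => by
      refine le_trans ?_ (h1' T)
      have hg := hγ T
      have hr := hρ0 T
      have hn := (hH T T.2.1).norm_derivH_le (j := 1) (by norm_num) hs
      rw [norm_smul, norm_smul, norm_inv, norm_inv, Real.norm_of_nonneg hr,
        Real.norm_of_nonneg hg.le, inv_mul_eq_div (minGap (H T)), ← mul_assoc]
      gcongr
      calc ρ T * (ρ T)⁻¹ * (‖derivH 1 (H T) s‖ / minGap (H T))
          ≤ 1 * (maxNorm 1 (H T) / minGap (H T)) := by
            gcongr
            exact mul_inv_le_one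
        _ = _ := one_mul _)
    (fun T => (hU T T.2.1).rescale (hγ T).ne') G
    (fun T s hs m hm hE => hG T T.2.1 s hs m hm
      (mul_left_cancel₀ (inv_ne_zero (hγ T).ne') hE))
  refine IsBigO.of_bound (|C| * (2 / c)) ?_
  filter_upwards [hgood] with T hT
  have hb := hC ⟨T, hT⟩
  simp only [boundaryTerm_rescale (hgap T hT.1).ne'] at hb
  have hγT := hgap T hT.1
  have hT0 := hT.1
  calc ‖adiabaticError (U T) (ψ T) G - boundaryTerm T (E T) (ψ T) G‖
      ≤ |C| * ((ρ ⟨T, hT⟩ ^ 2 + ρ ⟨T, hT⟩ ^ 3) / (minGap (H T) * T) ^ 2) := by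
        have := hρ0 ⟨T, hT⟩
        refine hb.trans ?_
        gcongr
        exact le_abs_self C
    _ ≤ |C| * ((2 / c * (minGap (H T) * Delta1 (H T))) / (minGap (H T) * T) ^ 2) := by
        gcongr
        exact hρD ⟨T, hT⟩
    _ = |C| * (2 / c) * (Delta1 (H T) / (minGap (H T) * T ^ 2)) := by
        field_simp
    _ ≤ |C| * (2 / c) * ‖Delta1 (H T) / (minGap (H T) * T ^ 2)‖ := by
        gcongr
        exact Real.le_norm_self _
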